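/- A *game* $G=\langle S,A_1,A_2,\delta,\mathcal O_1,\mathcal O_2\rangle$ (concurrent game of partial observation) has a finite set $S$ of states, finite nonempty sets $A_1,A_2$ of actions of the two players, a transition function $\delta:S\times A_1\times A_2\to\mathcal D(S)$ into the probability distributions on $S$, and partitions $\mathcal O_1,\mathcal O_2$ of $S$ into the observations of Player 1 and Player 2. Player $i$ has complete observation if $\mathcal O_i=\{\{s\}\mid s\in S\}$. $G$ is of complete observation ($\mathsf{Co}$) if both players have complete observation, one-sided ($\mathsf{Os}$) if at least one of them has; partial observation ($\mathsf{Pa}$) is no restriction. $G$ is turn-based ($\mathsf T$) if for every state $s$ the distribution $\delta(s,a,b)$ does not depend on $b$ or does not depend on $a$; concurrent ($\mathsf C$) is no restriction. $G$ is deterministic if every $\delta(s,a,b)$ is concentrated in one state. For $a\in\{\mathsf{Pa},\mathsf{Os},\mathsf{Co}\}$ and $b\in\{\mathsf C,\mathsf T\}$ let $\mathcal G_{ab}$ be the class of games with both restrictions. An objective is a Borel set $\phi\subseteq S^\omega$. Strategies are randomized: they map finite prefixes of plays (sequences of states) to distributions over the player's actions; a strategy of Player $i$ is observation-based if it has the same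 value on prefixes with the same sequence of observations of Player $i$. Let $\Pr_s^{\sigma,\pi}$ be the law of the play from $s$. In what follows $\sigma$ and $\pi$ range over the observation-based strategies of Player 1 and Player 2. The strategy $\sigma$ is almost-sure (positive) winning for $\phi$ from $s$ if $\Pr_s^{\sigma,\pi}(\phi)=1$ (resp. $>0$) for all $\pi$; the value is $\mathrm{val}^G(\phi)(s)=\sup_\sigma\inf_\pi\Pr_s^{\sigma,\pi}(\phi)$; and $\sigma$ is optimal for $\phi$ from $s$ if $\inf_\pi\Pr_s^{\sigma,\pi}(\phi)\ge\mathrm{val}^G(\phi)(s)$. **Theorem.** Let $a\in\{\mathsf{Pa},\mathsf{Os},\mathsf{Co}\}$ and $b\in\{\mathsf C,\mathsf T\}$, and let $a'=a$ if $a\ne\mathsf{Co}$ and $a'=\mathsf{Os}$ if $a=\mathsf{Co}$. There are an integer $k\ge1$ and an algorithm that runs in exponential time (time at most $2^{p(m)}$ on inputs of size $m$, for some polynomial $p$, where games are given explicitly, with probabilities as fractions in binary) and that transforms every game $G\in\mathcal G_{ab}$ with rational transition probabilities into a deterministic game $G'\in\mathcal G_{a'b}$ whose set of states $S'$ contains the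 set of states $S$ of $G$, such that for every objective $\phi$ in $G$ the set $$\phi'=\{s'_0s'_1s'_2\ldots\in S'^\omega \mid s'_0s'_ks'_{2k}\ldots\in\phi\}$$ is an objective in $G'$ for which the following assertions hold for all $s\in S$. 1. There is an observation-based almost-sure (resp. positive) winning strategy from $s$ for $\phi$ in $G$ iff there is an observation-based almost-sure (resp. positive) winning strategy from $s$ for $\phi'$ in $G'$. 2. $\mathrm{val}^G(\phi)(s)=\mathrm{val}^{G'}(\phi')(s)$; and there is an observation-based optimal strategy for $\phi$ from $s$ in $G$ iff there is an observation-based optimal strategy for $\phi'$ from $s$ in $G'$. -/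

import Mathlib

open MeasureTheory ProbabilityTheory
open scoped ENNReal

noncomputable section

/-! ### Concurrent games of partial observation -/

/-- A concurrent game of partial observation with rational transition probabilities. The partition
of the states into observations of Player `i` is given by the equivalence relation `obsᵢ`. -/
structure Game (S A₁ A₂ : Type) [Fintype S] where
  /-- `δ s a b s'` is the probability to move from `s` to `s'` under the actions `a`, `b`. -/
  δ : S → A₁ → A₂ → S → ℚ
  δ_nonneg : ∀ s a b s', 0 ≤ δ s a b s'
  δ_sum : ∀ s a b, ∑ s', δ s a b s' = 1
  obs₁ : Setoid S
  obs₂ : Setoid S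

namespace Game

variable {S A₁ A₂ : Type} [Fintype S] (G : Game S A₁ A₂)

/-- All observations are singletons: every state is visible. -/
def CompleteObs (r : Setoid S) : Prop := ∀ s s', r s s' → s = s'

/-- At least one of the players has complete observation. -/
def OneSided : Prop := CompleteObs G.obs₁ ∨ CompleteObs G.obs₂

/-- Both players have complete observation. -/
def Complete : Prop := CompleteObs G.obs₁ ∧ CompleteObs G.obs₂

/-- The transition function in `s` does not depend on the action of Player 2. -/
def IsPlayer1State (s : S) : Prop := ∀ a b b', G.δ s a b = G.δ s a b'

/-- The transition function in `s` does not depend on the action of Player 1. -/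
def IsPlayer2State (s : S) : Prop := ∀ a a' b, G.δ s a b = G.δ s a' b

def TurnBased : Prop := ∀ s, G.IsPlayer1State s ∨ G.IsPlayer2State s

def Deterministic : Prop := ∀ s a b, ∃ s', G.δ s a b s' = 1

/-! #### Plays and strategies -/

def IsPlay (ρ : ℕ → S) : Prop := ∀ i, ∃ a b, 0 < G.δ (ρ i) a b (ρ (i + 1))

/-- The finite prefixes `s₀ … sₘ` of plays. -/
def Prefs : Set (List S) := {l | ∃ ρ, G.IsPlay ρ ∧ ∃ m : ℕ, l = (List.range (m + 1)).map ρ}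

/-- Equality of the observation sequences of two finite sequences of states. -/
def SameObs (r : Setoid S) (l l' : List S) : Prop := List.Forall₂ (fun s s' => r s s') l l'

/-- The observation-based randomized strategies of a player with action set `A` and observations
`r`. A strategy maps the prefixes of plays to distributions over actions; values at lists that are
not prefixes of plays are irrelevant. -/
def ObsStrategy (A : Type) (r : Setoid S) : Type :=
  {σ : List S → PMF A // ∀ l ∈ G.Prefs, ∀ l' ∈ G.Prefs, SameObs r l l' → σ l = σ l'}

abbrev Strategy₁ : Type := G.ObsStrategy A₁ G.obs₁

abbrev Strategy₂ : Type := G.ObsStrategy A₂ G.obs₂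

/-! #### The probability measure on plays -/

theorem sum_ofReal_δ (s : S) (a : A₁) (b : A₂) :
    ∑ s', ENNReal.ofReal (G.δ s a b s' : ℝ) = 1 := by
  rw [← ENNReal.ofReal_sum_of_nonneg (fun s' _ => by exact_mod_cast G.δ_nonneg s a b s'),
    ← Rat.cast_sum, G.δ_sum, Rat.cast_one, ENNReal.ofReal_one]

/-- The transition function as a distribution over the successor states. -/
def stepPMF (s : S) (a : A₁) (b : A₂) : PMF S :=
  PMF.ofFintype (fun s' => ENNReal.ofReal (G.δ s a b s' : ℝ)) (G.sum_ofReal_δ s a b)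

/-- The distribution of the next state after the history `l` with last state `s`: the players choose
their actions independently, and then the successor is chosen by the transition function. -/
def nextPMF (σ : List S → PMF A₁) (π : List S → PMF A₂) (l : List S) (s : S) : PMF S :=
  (σ l).bind fun a => (π l).bind fun b => G.stepPMF s a b

/-- The list `s₀ … sₘ` of the states of a history. -/
def histList {m : ℕ} (h : Finset.Iic m → S) : List S :=
  List.ofFn fun i : Fin (m + 1) => h ⟨i, Finset.mem_Iic.2 (Nat.le_of_lt_succ i.2)⟩

variable [MeasurableSpace S] [DiscreteMeasurableSpace S]

/-- The kernel from the histories `s₀ … sₘ` to the next state. -/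
def nextKernel (σ : List S → PMF A₁) (π : List S → PMF A₂) (m : ℕ) :
    Kernel (Finset.Iic m → S) S where
  toFun h := (G.nextPMF σ π (histList h) (h ⟨m, Finset.mem_Iic.2 le_rfl⟩)).toMeasure
  measurable' := Measurable.of_discrete

instance (σ : List S → PMF A₁) (π : List S → PMF A₂) (m : ℕ) :
    IsMarkovKernel (G.nextKernel σ π m) :=
  ⟨fun _ => PMF.toMeasure.isProbabilityMeasure _⟩

/-- The law of the play from the state `s` under the strategies `σ` and `π` (the measure on infinite
sequences of states given by the Ionescu-Tulcea theorem). -/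
def playMeasure (σ : G.Strategy₁) (π : G.Strategy₂) (s : S) : Measure (ℕ → S) :=
  Kernel.traj (X := fun _ => S) (G.nextKernel σ.1 π.1) 0 (fun _ => s)

/-! #### Winning, values, optimality -/

def AlmostSureWinning (φ : Set (ℕ → S)) (s : S) (σ : G.Strategy₁) : Prop :=
  ∀ π : G.Strategy₂, G.playMeasure σ π s φ = 1

def PositiveWinning (φ : Set (ℕ → S)) (s : S) (σ : G.Strategy₁) : Prop :=
  ∀ π : G.Strategy₂, 0 < G.playMeasure σ π s φ

/-- The value for Player 1; the supremum and the infimum are taken in `[0, ∞]`. -/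
def value (φ : Set (ℕ → S)) (s : S) : ℝ≥0∞ :=
  ⨆ σ : G.Strategy₁, ⨅ π : G.Strategy₂, G.playMeasure σ π s φ

def Optimal (φ : Set (ℕ → S)) (s : S) (σ : G.Strategy₁) : Prop :=
  G.value φ s ≤ ⨅ π : G.Strategy₂, G.playMeasure σ π s φ

end Game

/-! ### Classes of games -/

inductive ObsClass where
  | partialObs
  | oneSided
  | complete

inductive Interaction where
  | concurrent
  | turnBased

/-- `a' = a` if `a` is not the class of complete observation, and one-sided otherwise. -/
def ObsClass.atLeastOneSided : ObsClass → ObsClass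
  | partialObs => partialObs
  | oneSided => oneSided
  | complete => oneSided

/-- The class of games given by an observation restriction and a mode of interaction; partial
observation and concurrent interaction are no restriction. -/
def Game.InClass {S A₁ A₂ : Type} [Fintype S] (G : Game S A₁ A₂) (a : ObsClass) (b : Interaction) :
    Prop :=
  (match a with
    | .partialObs => True
    | .oneSided => G.OneSided
    | .complete => G.Complete) ∧
  (match b with
    | .concurrent => True
    | .turnBased => G.TurnBased)

/-! ### Binary trees as data, and the encoding of games

The states and actions of a game that is given to an algorithm are numbered. -/

/-- Binary trees. -/
inductive Data where
  | nil : Data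
  | cons : Data → Data → Data

namespace Data

/-- The number of nodes. -/
def size : Data → ℕ
  | nil => 1
  | cons x y => 1 + x.size + y.size

def ofList : List Data → Data
  | [] => nil
  | x :: l => cons x (ofList l)

def ofBool : Bool → Data
  | false => nil
  | true => cons nil nil

/-- Unary numbers (used for the numbers of states and actions only). -/
def ofNatUnary (n : ℕ) : Data := ofList (List.replicate n nil)

/-- Binary numbers, least significant bit first. -/
def ofNat (n : ℕ) : Data := ofList (n.bits.map ofBool)

/-- Nonnegative rational numbers in lowest terms, numerator and denominator in binary. -/
def ofRat (q : ℚ) : Data := cons (ofNat q.num.natAbs) (ofNat q.den)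

/-- Tables of values. -/
def ofFun {n : ℕ} (f : Fin n → Data) : Data := ofList (List.ofFn f)

open Classical in
/-- Equivalence relations as Boolean matrices. -/
def ofSetoid {n : ℕ} (r : Setoid (Fin n)) : Data :=
  ofFun fun s => ofFun fun s' => ofBool (decide (r s s'))

end Data

/-- A game with states `0, …, nS - 1` and nonempty action sets `0, …, nAᵢ - 1`. -/
structure FinGame where
  nS : ℕ
  nA₁ : ℕ
  nA₂ : ℕ
  nA₁_pos : 0 < nA₁
  nA₂_pos : 0 < nA₂
  toGame : Game (Fin nS) (Fin nA₁) (Fin nA₂)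

/-- The explicit description of a game: sizes, transition table, observations. -/
def FinGame.encode (G : FinGame) : Data :=
  Data.ofList [
    Data.ofNatUnary G.nS, Data.ofNatUnary G.nA₁, Data.ofNatUnary G.nA₂,
    Data.ofFun fun s => Data.ofFun fun a => Data.ofFun fun b => Data.ofFun fun s' =>
      Data.ofRat (G.toGame.δ s a b s'),
    Data.ofSetoid G.toGame.obs₁, Data.ofSetoid G.toGame.obs₂]

/-! ### Programs and their running time -/

/-- While-programs over binary trees; a program reads one tree and outputs one tree. -/
inductive Program where
  /-- the leaf -/
  | nil
  /-- the input itself -/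
  | id
  /-- the left subtree -/
  | hd
  /-- the right subtree -/
  | tl
  /-- the tree with the outputs of `p` and of `q` as subtrees -/
  | cons (p q : Program)
  /-- first `p`, then `q` -/
  | seq (p q : Program)
  /-- `p` if the output of `c` is not the leaf, `q` otherwise -/
  | ite (c p q : Program)
  /-- apply `p` as long as the output of `c` is not the leaf -/
  | loop (c p : Program)

/-- `Runs p x y t`: on input `x` the program `p` halts with output `y` after time `t`. Every
instruction is charged with the size of the tree it works on (so that copying is paid for, and the
size of the output is at most `t`), in addition to the time of the subprograms that are run. Up to
a polynomial, this is the running time of multitape Turing machines. -/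
inductive Runs : Program → Data → Data → ℕ → Prop
  | nil (x : Data) : Runs .nil x .nil (1 + x.size)
  | id (x : Data) : Runs .id x x (1 + x.size)
  | hd_nil : Runs .hd .nil .nil (1 + Data.nil.size)
  | hd_cons (x y : Data) : Runs .hd (.cons x y) x (1 + (Data.cons x y).size)
  | tl_nil : Runs .tl .nil .nil (1 + Data.nil.size)
  | tl_cons (x y : Data) : Runs .tl (.cons x y) y (1 + (Data.cons x y).size)
  | cons {p q : Program} {x y z : Data} {t u : ℕ} :
      Runs p x y t → Runs q x z u → Runs (.cons p q) x (.cons y z) (t + u + (1 + x.size))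
  | seq {p q : Program} {x y z : Data} {t u : ℕ} :
      Runs p x y t → Runs q y z u → Runs (.seq p q) x z (t + u + (1 + x.size))
  | ite_true {c p q : Program} {x d e y : Data} {t u : ℕ} :
      Runs c x (.cons d e) t → Runs p x y u → Runs (.ite c p q) x y (t + u + (1 + x.size))
  | ite_false {c p q : Program} {x y : Data} {t u : ℕ} :
      Runs c x .nil t → Runs q x y u → Runs (.ite c p q) x y (t + u + (1 + x.size))
  | loop_stop {c p : Program} {x : Data} {t : ℕ} :
      Runs c x .nil t → Runs (.loop c p) x x (t + (1 + x.size))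
  | loop_step {c p : Program} {x d e y z : Data} {t u v : ℕ} :
      Runs c x (.cons d e) t → Runs p x y u → Runs (.loop c p) y z v →
        Runs (.loop c p) x z (t + u + v + (1 + x.size))

/-! ### The objective of the constructed game -/

/-- The sequences whose states at the positions `0, k, 2k, …` are the images under `ι` of the states
of a sequence in `φ`. -/
def liftObjective {S S' : Type} (k : ℕ) (ι : S → S') (φ : Set (ℕ → S)) : Set (ℕ → S') :=
  {ρ' | ∃ ρ ∈ φ, ∀ i, ρ' (k * i) = ι (ρ i)}

end

/-!
The randomness of the transitions is replaced by the choices of the players. Let `N` be a common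
denominator of the transition probabilities, and for every state and pair of actions let the numbers
modulo `N` select successors, each successor by as many numbers as its probability prescribes. In
the new game (`Game.determinize`) every player chooses a number besides his action, and the sum of
the two numbers selects the successor. A player who chooses his number uniformly makes the sum
uniform whatever the opponent does, so each player alone can enforce the transition probabilities of
the given game. Hence the strategies of both players can be translated in both directions (a uniform
number is added, or the numbers are forgotten), with the same law of the play if one player uses a
translated strategy. This relation is isolated as `Game.Simulation`; it is all that is needed for
the transfer of winning strategies, values, and optimal strategies.

The sum of two numbers is a concurrent choice. For turn-based games every move is therefore split
into two turns (`Game.sequentialize`): Player 2 chooses first and leads the play into an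
intermediate state, in which Player 1 chooses. Player 1 does not see the choice of Player 2.

* For games of partial observation, Player 2 does not see it either. Then observations carry the
  same information as in the given game, and strategies correspond to each other directly
  (`Game.simulationHidden`).
* If the result has to be one-sided, Player 2 is given complete observation; he must have had it in
  the given game. Now his strategies may depend on his earlier choices, and these have to be averaged
  out: the translated strategy chooses an action with its conditional probability, given the states
  of the history (`Game.averaged`). Since the given game is turn-based, the probability of a move
  is the product of a factor that depends on the strategy of Player 1 only and one that depends on
  the choice of Player 2 only (`Game.Factors`); the former cancels in the conditional probability,
  so the translation does not depend on the opponent (`Game.simulationVisible`).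

If only Player 1 has complete observation, the players are exchanged before and after the
construction.

For the running time, `Computes μ f g` says that a program finds `g i` from `f i` in time polynomial
in `μ i`. It is closed under the operations on lists, tables and unary numbers from which the tables
of the new games are built. The denominator `N` is at most `2 ^ m` for games of size `m`
(`FinGame.commonDen_le`), so with `μ = 2 ^ m` it can be handled in unary.
-/

noncomputable section

namespace Game

/-! ### The law of the play for arbitrary strategies -/

theorem frestrictLe_surj {S : Type} (n : ℕ) (h : Finset.Iic n → S) :
    ∃ ρ : ℕ → S, Preorder.frestrictLe (π := fun _ => S) n ρ = h := by
  refine ⟨fun i => h ⟨min i n, Finset.mem_Iic.2 (min_le_right _ _)⟩, ?_⟩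
  funext ⟨i, hi⟩
  have : min i n = i := min_eq_left (Finset.mem_Iic.1 hi)
  simp [this]

theorem histList_frestrictLe {S : Type} (ρ : ℕ → S) (n : ℕ) :
    histList (Preorder.frestrictLe (π := fun _ => S) n ρ) = (List.range n).map ρ ++ [ρ n] := by
  have : (List.range n).map ρ ++ [ρ n] = (List.range (n + 1)).map ρ := by
    simp [List.range_succ]
  rw [this]
  apply List.ext_getElem
  · simp [histList]
  · intro i h₁ h₂
    simp only [histList, List.getElem_ofFn, List.getElem_map, List.getElem_range,
      Preorder.frestrictLe_apply]

/-- A function of a history, as a function on the restrictions of plays. -/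
def onHist {S : Type} (F : List S → S → ℝ≥0∞) (n : ℕ) (h : Finset.Iic n → S) : ℝ≥0∞ :=
  F (histList h).dropLast (h ⟨n, Finset.mem_Iic.2 le_rfl⟩)

theorem onHist_frestrictLe {S : Type} (F : List S → S → ℝ≥0∞) (n : ℕ) (ρ : ℕ → S) :
    onHist F n (Preorder.frestrictLe (π := fun _ => S) n ρ) = F ((List.range n).map ρ) (ρ n) := by
  simp [onHist, histList_frestrictLe]

section Law

variable {S A₁ A₂ : Type} [Fintype S] (G : Game S A₁ A₂)
  (σ : List S → PMF A₁) (π : List S → PMF A₂)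

/-- The mean of `F` after one more move, as a function of the history. A history is split into its
last state and the list of the states before. -/
def stepMean (F : List S → S → ℝ≥0∞) (l : List S) (s : S) : ℝ≥0∞ :=
  ∑ t, G.nextPMF σ π (l ++ [s]) s t * F (l ++ [s]) t

/-- The mean of `F` over the histories with `n` moves from `s`. -/
def prefixMean (s : S) : ℕ → (List S → S → ℝ≥0∞) → ℝ≥0∞
  | 0, F => F [] s
  | n + 1, F => prefixMean s n (G.stepMean σ π F)

section Measure

variable [MeasurableSpace S] [DiscreteMeasurableSpace S]

/-- `Game.playMeasure` for strategies that need not be observation-based. -/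
def law (s : S) : Measure (ℕ → S) :=
  Kernel.traj (X := fun _ => S) (G.nextKernel σ π) 0 (fun _ => s)

instance (s : S) : IsProbabilityMeasure (G.law σ π s) := by
  unfold law; infer_instance

/-- The mean of a function of the history only involves finitely many steps. -/
theorem lintegral_law_partialTraj (s : S) (n : ℕ) (F : List S → S → ℝ≥0∞) :
    ∫⁻ ρ, F ((List.range n).map ρ) (ρ n) ∂(G.law σ π s) =
      ∫⁻ h, onHist F n h ∂(Kernel.partialTraj (X := fun _ => S) (G.nextKernel σ π) 0 n
        (fun _ => s)) := by
  rw [← Kernel.traj_map_frestrictLe_apply, lintegral_map (Measurable.of_discrete)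
    (Preorder.measurable_frestrictLe n)]
  simp only [onHist_frestrictLe]
  rfl

/-- The law of the play is described by the recursion `prefixMean`. -/
theorem lintegral_law (s : S) (n : ℕ) (F : List S → S → ℝ≥0∞) :
    ∫⁻ ρ, F ((List.range n).map ρ) (ρ n) ∂(G.law σ π s) = G.prefixMean σ π s n F := by
  induction n generalizing F with
  | zero =>
    rw [lintegral_law_partialTraj, Kernel.partialTraj_self, Kernel.lintegral_id'
      Measurable.of_discrete]
    simp [onHist, histList, prefixMean]
  | succ n ih =>
    rw [prefixMean, ← ih, lintegral_law_partialTraj, lintegral_law_partialTraj,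
      Kernel.partialTraj_succ_eq_comp (Nat.zero_le n), Kernel.lintegral_comp _ _ _
        Measurable.of_discrete]
    congr 1
    funext h
    rw [Kernel.partialTraj_succ_self, Kernel.lintegral_map _ (by fun_prop) _
      Measurable.of_discrete, Kernel.lintegral_id_prod Measurable.of_discrete,
      Kernel.lintegral_map _ (by fun_prop) _ Measurable.of_discrete]
    obtain ⟨ρ, rfl⟩ := frestrictLe_surj n h
    rw [onHist_frestrictLe, stepMean, lintegral_fintype]
    refine Finset.sum_congr rfl fun t _ => ?_
    rw [mul_comm]
    congr 1
    · simp only [nextKernel, Kernel.coe_mk, histList_frestrictLe]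
      rw [PMF.toMeasure_apply_singleton _ _ (MeasurableSet.singleton t)]
      rfl
    · have : IicProdIoc (X := fun _ => S) n (n + 1)
          (Preorder.frestrictLe (π := fun _ => S) n ρ,
            MeasurableEquiv.piSingleton (X := fun _ => S) n t) =
          Preorder.frestrictLe (π := fun _ => S) (n + 1) (Function.update ρ (n + 1) t) := by
        funext ⟨i, hi⟩
        rw [Finset.mem_Iic] at hi
        by_cases h : i ≤ n
        · simp [IicProdIoc, h, Function.update, show i ≠ n + 1 by omega]
        · obtain rfl : i = n + 1 := by omega
          simp [IicProdIoc, MeasurableEquiv.piSingleton]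
      rw [this, onHist_frestrictLe]
      have : (List.range (n + 1)).map (Function.update ρ (n + 1) t) =
          (List.range n).map ρ ++ [ρ n] := by
        rw [List.range_succ, List.map_append]
        congr 1
        · refine List.map_congr_left fun i hi => ?_
          rw [List.mem_range] at hi
          rw [Function.update_of_ne (by omega)]
        · simp
      rw [this]
      simp

/-- Two finite measures on the sequences of states agree if they give the same means to all
functions of histories. -/
theorem measure_ext_of_prefix {μ ν : Measure (ℕ → S)} [IsFiniteMeasure μ] [IsFiniteMeasure ν]
    (h : ∀ n (F : List S → S → ℝ≥0∞), ∫⁻ ρ, F ((List.range n).map ρ) (ρ n) ∂μ =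
      ∫⁻ ρ, F ((List.range n).map ρ) (ρ n) ∂ν) : μ = ν := by
  classical
  have key : ∀ n, μ.map (Preorder.frestrictLe (π := fun _ => S) n) =
      ν.map (Preorder.frestrictLe (π := fun _ => S) n) := by
    intro n
    refine Measure.ext_of_singleton fun x => ?_
    obtain ⟨ρ₀, rfl⟩ := frestrictLe_surj n x
    rw [Measure.map_apply (Preorder.measurable_frestrictLe n) (MeasurableSet.singleton _),
      Measure.map_apply (Preorder.measurable_frestrictLe n) (MeasurableSet.singleton _)]
    have hm : MeasurableSet ((Preorder.frestrictLe (π := fun _ => S) n) ⁻¹'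
      {Preorder.frestrictLe (π := fun _ => S) n ρ₀}) :=
      (Preorder.measurable_frestrictLe n) (MeasurableSet.singleton _)
    have := h n (fun l s => if l = (List.range n).map ρ₀ ∧ s = ρ₀ n then 1 else 0)
    have hind : ∀ ρ : ℕ → S, (if (List.range n).map ρ = (List.range n).map ρ₀ ∧ ρ n = ρ₀ n
        then (1 : ℝ≥0∞) else 0) = ((Preorder.frestrictLe (π := fun _ => S) n) ⁻¹'
        {Preorder.frestrictLe (π := fun _ => S) n ρ₀}).indicator 1 ρ := by
      intro ρ
      rw [Set.indicator_apply]
      congr 1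
      rw [eq_iff_iff, Set.mem_preimage, Set.mem_singleton_iff, funext_iff]
      simp only [Preorder.frestrictLe_apply, Subtype.forall, Finset.mem_Iic, List.map_inj_left,
        List.mem_range]
      constructor
      · rintro ⟨h₁, h₂⟩ a ha
        rcases Nat.lt_or_eq_of_le ha with h | rfl
        · exact h₁ a h
        · exact h₂
      · exact fun h => ⟨fun a ha => h a ha.le, h n le_rfl⟩
    simp only [hind] at this
    rwa [lintegral_indicator_one hm, lintegral_indicator_one hm] at this
  have hP : IsProjectiveMeasureFamily (α := fun _ => S)
      (fun I : Finset ℕ => ν.map (I.restrict (π := fun _ => S))) := by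
    intro I J hJ
    rw [Measure.map_map (Finset.measurable_restrict₂ _) (Finset.measurable_restrict _)]
    rfl
  have hμ : IsProjectiveLimit (α := fun _ => S) μ
      (fun I : Finset ℕ => ν.map (I.restrict (π := fun _ => S))) := by
    rw [isProjectiveLimit_nat_iff hP]
    exact key
  have : ∀ I : Finset ℕ, IsFiniteMeasure ((fun I : Finset ℕ =>
      ν.map (I.restrict (π := fun _ => S))) I) := fun I => by
    dsimp only; infer_instance
  exact hμ.unique (fun I => rfl)

theorem law_congr_of_prefixMean {σ' : List S → PMF A₁} {π' : List S → PMF A₂} {s : S}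
    (h : ∀ n F, G.prefixMean σ π s n F = G.prefixMean σ' π' s n F) :
    G.law σ π s = G.law σ' π' s :=
  measure_ext_of_prefix fun n F => by rw [lintegral_law, lintegral_law, h]

end Measure

/-! ### Means over histories -/

theorem exists_pos_of_nextPMF_ne_zero {l : List S} {s t : S} (h : G.nextPMF σ π l s t ≠ 0) :
    ∃ a b, 0 < G.δ s a b t := by
  rw [← PMF.mem_support_iff, nextPMF, PMF.mem_support_bind_iff] at h
  obtain ⟨a, -, h⟩ := h
  rw [PMF.mem_support_bind_iff] at h
  obtain ⟨b, -, h⟩ := h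
  rw [PMF.mem_support_iff, stepPMF, PMF.ofFintype_apply] at h
  refine ⟨a, b, ?_⟩
  by_contra h'
  apply h
  rw [ENNReal.ofReal_eq_zero]
  exact_mod_cast not_lt.1 h'

/-- The mean of `F` depends only on the values of `F` on histories with an invariant of the game. -/
theorem prefixMean_congr {s : S} (I : List S → S → Prop) (h₀ : I [] s)
    (hI : ∀ l s t, I l s → G.nextPMF σ π (l ++ [s]) s t ≠ 0 → I (l ++ [s]) t) (n : ℕ)
    {F F' : List S → S → ℝ≥0∞} (h : ∀ l s, I l s → F l s = F' l s) :
    G.prefixMean σ π s n F = G.prefixMean σ π s n F' := by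
  induction n generalizing F F' with
  | zero => exact h _ _ h₀
  | succ n ih =>
    refine ih fun l s hl => Finset.sum_congr rfl fun t _ => ?_
    by_cases ht : G.nextPMF σ π (l ++ [s]) s t = 0
    · rw [ht, zero_mul, zero_mul]
    · rw [h _ _ (hI l s t hl ht)]

theorem prefixMean_one (s : S) (n : ℕ) : G.prefixMean σ π s n (fun _ _ => 1) = 1 := by
  induction n with
  | zero => rfl
  | succ n ih =>
    rw [prefixMean]
    convert ih using 2
    funext l s
    rw [stepMean]
    simp only [mul_one]
    rw [← tsum_fintype (L := .unconditional S), PMF.tsum_coe]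

/-! ### Prefixes of plays -/

variable {σ π}

theorem exists_play [Nonempty A₁] [Nonempty A₂] (s : S) : ∃ ρ, G.IsPlay ρ ∧ ρ 0 = s := by
  have hex : ∀ s : S, ∃ t, ∃ a b, 0 < G.δ s a b t := by
    intro s
    obtain ⟨a⟩ := ‹Nonempty A₁›
    obtain ⟨b⟩ := ‹Nonempty A₂›
    by_contra! h
    have h₁ := G.δ_sum s a b
    have h₂ : ∑ t, G.δ s a b t ≤ 0 := Finset.sum_nonpos fun t _ => h t a b
    rw [h₁] at h₂
    norm_num at h₂
  choose nxt hn using hex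
  refine ⟨fun i => nxt^[i] s, fun i => ?_, rfl⟩
  simpa only [Function.iterate_succ_apply'] using hn _

theorem singleton_mem_prefs [Nonempty A₁] [Nonempty A₂] (s : S) : [s] ∈ G.Prefs := by
  obtain ⟨ρ, hρ, h₀⟩ := G.exists_play s
  exact ⟨ρ, hρ, 0, by simp [h₀]⟩

theorem append_mem_prefs [Nonempty A₁] [Nonempty A₂] {l : List S} {s t : S}
    (hl : l ++ [s] ∈ G.Prefs) (h : ∃ a b, 0 < G.δ s a b t) : l ++ [s] ++ [t] ∈ G.Prefs := by
  obtain ⟨ρ, hρ, m, hm⟩ := hl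
  obtain ⟨τ, hτ, hτ₀⟩ := G.exists_play t
  have hs : s = ρ m := by
    have := congrArg List.getLast? hm
    simpa [List.range_succ] using this
  refine ⟨fun i => if i ≤ m then ρ i else τ (i - (m + 1)), fun i => ?_, m + 1, ?_⟩
  · rcases lt_trichotomy i m with hi | rfl | hi
    · simpa [hi.le, Nat.succ_le_of_lt hi] using hρ i
    · simpa [hτ₀, ← hs] using h
    · have h₁ : ¬ i ≤ m := by omega
      have h₂ : ¬ i + 1 ≤ m := by omega
      have h₃ : i + 1 - (m + 1) = i - (m + 1) + 1 := by omega
      simp only [h₁, h₂, if_false, h₃]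
      exact hτ _
  · rw [hm, List.range_succ (n := m + 1), List.map_append]
    congr 1
    · refine List.map_congr_left fun i hi => ?_
      rw [List.mem_range] at hi
      simp [show i ≤ m by omega]
    · simp [hτ₀]

/-- The law of the play depends only on the values of the strategies at prefixes of plays. -/
theorem law_congr [MeasurableSpace S] [DiscreteMeasurableSpace S]
    {σ' : List S → PMF A₁} {π' : List S → PMF A₂}
    (hσ : ∀ l ∈ G.Prefs, σ l = σ' l) (hπ : ∀ l ∈ G.Prefs, π l = π' l) (s : S) :
    G.law σ π s = G.law σ' π' s := by
  have : Nonempty A₁ := (σ []).support_nonempty.to_type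
  have : Nonempty A₂ := (π []).support_nonempty.to_type
  refine G.law_congr_of_prefixMean _ _ fun n => ?_
  induction n with
  | zero => exact fun F => rfl
  | succ n ih =>
    intro F
    rw [prefixMean, prefixMean, ← ih]
    refine G.prefixMean_congr σ π (fun l s => l ++ [s] ∈ G.Prefs) (G.singleton_mem_prefs s) ?_ n ?_
    · exact fun l s t hl ht => G.append_mem_prefs hl (G.exists_pos_of_nextPMF_ne_zero _ _ ht)
    · intro l s hl
      simp only [stepMean, nextPMF, hσ _ hl, hπ _ hl]

end Law

/-! ### Strategies that are observation-based on all lists -/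

section SameObs

variable {S : Type}

theorem SameObs.refl (r : Setoid S) (l : List S) : SameObs r l l :=
  List.forall₂_same.2 fun x _ => r.refl' x

theorem SameObs.symm {r : Setoid S} {l l' : List S} (h : SameObs r l l') : SameObs r l' l :=
  List.Forall₂.flip (h.imp fun _ _ hab => r.symm' hab)

theorem SameObs.trans {r : Setoid S} {l₁ l₂ l₃ : List S} (h : SameObs r l₁ l₂)
    (h' : SameObs r l₂ l₃) : SameObs r l₁ l₃ := by
  unfold SameObs at *
  induction h generalizing l₃ with
  | nil => exact h'
  | cons hab _ ih =>
    cases h' with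
    | cons hbc h'' => exact .cons (r.trans' hab hbc) (ih h'')

theorem SameObs.eq {r : Setoid S} (hr : CompleteObs r) {l l' : List S} (h : SameObs r l l') :
    l = l' :=
  List.forall₂_eq_eq_eq ▸ h.imp fun _ _ hab => hr _ _ hab

end SameObs

section Total

variable {S A₁ A₂ : Type} [Fintype S] (G : Game S A₁ A₂)

/-- The maps from lists to distributions over actions that respect the observations on all lists,
also on those that are not prefixes of plays. -/
abbrev TotalStrategy (A : Type) (r : Setoid S) : Type :=
  {τ : List S → PMF A // ∀ l l', SameObs r l l' → τ l = τ l'}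

open Classical in
/-- Every observation-based strategy agrees on the prefixes of plays with one that respects the
observations on all lists: a list with the observations of some prefix gets the value at that
prefix. -/
theorem exists_total {A : Type} {r : Setoid S} (σ : G.ObsStrategy A r) :
    ∃ τ : TotalStrategy A r, ∀ l ∈ G.Prefs, σ.1 l = τ.1 l := by
  refine ⟨⟨fun l => if h : ∃ l', l' ∈ G.Prefs ∧ SameObs r l l' then σ.1 h.choose else σ.1 [],
    fun l₁ l₂ h => ?_⟩, fun l hl => ?_⟩
  · have : (fun l' => l' ∈ G.Prefs ∧ SameObs r l₁ l') =
        fun l' => l' ∈ G.Prefs ∧ SameObs r l₂ l' := by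
      funext l'
      exact propext (and_congr_right fun _ => ⟨fun h' => h.symm.trans h', fun h' => h.trans h'⟩)
    simp only [this]
  · have h : ∃ l', l' ∈ G.Prefs ∧ SameObs r l l' := ⟨l, hl, SameObs.refl r l⟩
    simp only [dif_pos h]
    exact σ.2 l hl _ h.choose_spec.1 h.choose_spec.2

/-- The restriction of a total strategy. -/
def TotalStrategy.toObs {A : Type} {r : Setoid S} (τ : TotalStrategy A r) : G.ObsStrategy A r :=
  ⟨τ.1, fun l _ l' _ h => τ.2 l l' h⟩

end Total

end Game

namespace Game

/-! ### Simulations of games -/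

section Simulation

variable {S A₁ A₂ S' A₁' A₂' : Type} [Fintype S] [Fintype S']
  [MeasurableSpace S] [DiscreteMeasurableSpace S] [MeasurableSpace S'] [DiscreteMeasurableSpace S']

/-- `G'` simulates one move of `G` by `k` moves: the strategies of both players can be translated in
both directions in such a way that a translated strategy of one player and any strategy of the
opponent give the objectives the probability that they have in the other game if the opponent
translates. The translation of the strategy of a player must not depend on the opponent. -/
structure Simulation (G : Game S A₁ A₂) (G' : Game S' A₁' A₂') (ι : S → S') (k : ℕ) where
  lift₁ : TotalStrategy A₁ G.obs₁ → TotalStrategy A₁' G'.obs₁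
  lift₂ : TotalStrategy A₂ G.obs₂ → TotalStrategy A₂' G'.obs₂
  proj₁ : TotalStrategy A₁' G'.obs₁ → TotalStrategy A₁ G.obs₁
  proj₂ : TotalStrategy A₂' G'.obs₂ → TotalStrategy A₂ G.obs₂
  law_lift₁ : ∀ σ π' s φ, MeasurableSet φ →
    G'.law (lift₁ σ).1 π'.1 (ι s) (liftObjective k ι φ) = G.law σ.1 (proj₂ π').1 s φ
  law_lift₂ : ∀ σ' π s φ, MeasurableSet φ →
    G'.law σ'.1 (lift₂ π).1 (ι s) (liftObjective k ι φ) = G.law (proj₁ σ').1 π.1 s φ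

namespace Simulation

variable {G : Game S A₁ A₂} {G' : Game S' A₁' A₂'} {ι : S → S'} {k : ℕ}
  {φ : Set (ℕ → S)} {s : S}

theorem exists_lift (H : Simulation G G' ι k) (hφ : MeasurableSet φ) (s : S) (σ : G.Strategy₁) :
    ∃ σ' : G'.Strategy₁, ∀ π' : G'.Strategy₂, ∃ π : G.Strategy₂,
      G'.playMeasure σ' π' (ι s) (liftObjective k ι φ) = G.playMeasure σ π s φ := by
  obtain ⟨τ, hτ⟩ := G.exists_total σ
  refine ⟨(H.lift₁ τ).toObs G', fun π' => ?_⟩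
  obtain ⟨η, hη⟩ := G'.exists_total π'
  refine ⟨(H.proj₂ η).toObs G, ?_⟩
  have h₁ : G'.playMeasure ((H.lift₁ τ).toObs G') π' (ι s) = G'.law (H.lift₁ τ).1 η.1 (ι s) :=
    G'.law_congr (fun _ _ => rfl) hη _
  have h₂ : G.playMeasure σ ((H.proj₂ η).toObs G) s = G.law τ.1 (H.proj₂ η).1 s :=
    G.law_congr hτ (fun _ _ => rfl) _
  rw [h₁, h₂, H.law_lift₁ _ _ _ _ hφ]

theorem exists_proj (H : Simulation G G' ι k) (hφ : MeasurableSet φ) (s : S)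
    (σ' : G'.Strategy₁) :
    ∃ σ : G.Strategy₁, ∀ π : G.Strategy₂, ∃ π' : G'.Strategy₂,
      G'.playMeasure σ' π' (ι s) (liftObjective k ι φ) = G.playMeasure σ π s φ := by
  obtain ⟨τ, hτ⟩ := G'.exists_total σ'
  refine ⟨(H.proj₁ τ).toObs G, fun π => ?_⟩
  obtain ⟨η, hη⟩ := G.exists_total π
  refine ⟨(H.lift₂ η).toObs G', ?_⟩
  have h₁ : G'.playMeasure σ' ((H.lift₂ η).toObs G') (ι s) = G'.law τ.1 (H.lift₂ η).1 (ι s) :=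
    G'.law_congr hτ (fun _ _ => rfl) _
  have h₂ : G.playMeasure ((H.proj₁ τ).toObs G) π s = G.law (H.proj₁ τ).1 η.1 s :=
    G.law_congr (fun _ _ => rfl) hη _
  rw [h₁, h₂, H.law_lift₂ _ _ _ _ hφ]

theorem almostSureWinning_iff (H : Simulation G G' ι k) (hφ : MeasurableSet φ) (s : S) :
    (∃ σ, G.AlmostSureWinning φ s σ) ↔
      ∃ σ, G'.AlmostSureWinning (liftObjective k ι φ) (ι s) σ := by
  constructor
  · rintro ⟨σ, hσ⟩
    obtain ⟨σ', h⟩ := H.exists_lift hφ s σ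
    exact ⟨σ', fun π' => by obtain ⟨π, hπ⟩ := h π'; rw [hπ]; exact hσ π⟩
  · rintro ⟨σ', hσ'⟩
    obtain ⟨σ, h⟩ := H.exists_proj hφ s σ'
    exact ⟨σ, fun π => by obtain ⟨π', hπ'⟩ := h π; rw [← hπ']; exact hσ' π'⟩

theorem positiveWinning_iff (H : Simulation G G' ι k) (hφ : MeasurableSet φ) (s : S) :
    (∃ σ, G.PositiveWinning φ s σ) ↔
      ∃ σ, G'.PositiveWinning (liftObjective k ι φ) (ι s) σ := by
  constructor
  · rintro ⟨σ, hσ⟩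
    obtain ⟨σ', h⟩ := H.exists_lift hφ s σ
    exact ⟨σ', fun π' => by obtain ⟨π, hπ⟩ := h π'; rw [hπ]; exact hσ π⟩
  · rintro ⟨σ', hσ'⟩
    obtain ⟨σ, h⟩ := H.exists_proj hφ s σ'
    exact ⟨σ, fun π => by obtain ⟨π', hπ'⟩ := h π; rw [← hπ']; exact hσ' π'⟩

theorem exists_lift_iInf_le (H : Simulation G G' ι k) (hφ : MeasurableSet φ) (s : S)
    (σ : G.Strategy₁) : ∃ σ' : G'.Strategy₁, ⨅ π : G.Strategy₂, G.playMeasure σ π s φ ≤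
      ⨅ π' : G'.Strategy₂, G'.playMeasure σ' π' (ι s) (liftObjective k ι φ) := by
  obtain ⟨σ', h⟩ := H.exists_lift hφ s σ
  exact ⟨σ', le_iInf fun π' => by obtain ⟨π, hπ⟩ := h π'; rw [hπ]; exact iInf_le _ π⟩

theorem exists_proj_iInf_le (H : Simulation G G' ι k) (hφ : MeasurableSet φ) (s : S)
    (σ' : G'.Strategy₁) : ∃ σ : G.Strategy₁,
      ⨅ π' : G'.Strategy₂, G'.playMeasure σ' π' (ι s) (liftObjective k ι φ) ≤
        ⨅ π : G.Strategy₂, G.playMeasure σ π s φ := by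
  obtain ⟨σ, h⟩ := H.exists_proj hφ s σ'
  exact ⟨σ, le_iInf fun π => by obtain ⟨π', hπ'⟩ := h π; rw [← hπ']; exact iInf_le _ π'⟩

theorem value_eq (H : Simulation G G' ι k) (hφ : MeasurableSet φ) (s : S) :
    G.value φ s = G'.value (liftObjective k ι φ) (ι s) := by
  refine le_antisymm (iSup_le fun σ => ?_) (iSup_le fun σ' => ?_)
  · obtain ⟨σ', h⟩ := H.exists_lift_iInf_le hφ s σ
    exact h.trans (le_iSup (fun σ' : G'.Strategy₁ =>
      ⨅ π' : G'.Strategy₂, G'.playMeasure σ' π' (ι s) (liftObjective k ι φ)) σ')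
  · obtain ⟨σ, h⟩ := H.exists_proj_iInf_le hφ s σ'
    exact h.trans (le_iSup (fun σ : G.Strategy₁ => ⨅ π : G.Strategy₂, G.playMeasure σ π s φ) σ)

theorem optimal_iff (H : Simulation G G' ι k) (hφ : MeasurableSet φ) (s : S) :
    (∃ σ, G.Optimal φ s σ) ↔ ∃ σ, G'.Optimal (liftObjective k ι φ) (ι s) σ := by
  unfold Optimal
  rw [← H.value_eq hφ]
  constructor
  · rintro ⟨σ, hσ⟩
    obtain ⟨σ', h⟩ := H.exists_lift_iInf_le hφ s σ
    exact ⟨σ', hσ.trans h⟩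
  · rintro ⟨σ', hσ'⟩
    obtain ⟨σ, h⟩ := H.exists_proj_iInf_le hφ s σ'
    exact ⟨σ, hσ'.trans h⟩

end Simulation

/-! ### Exchanging the players -/

/-- The game with the roles of the players exchanged. -/
def swap (G : Game S A₁ A₂) : Game S A₂ A₁ where
  δ s b a := G.δ s a b
  δ_nonneg s b a := G.δ_nonneg s a b
  δ_sum s b a := G.δ_sum s a b
  obs₁ := G.obs₂
  obs₂ := G.obs₁

theorem law_eq_of_nextPMF_eq {G : Game S A₁ A₂} {G' : Game S A₁' A₂'} {σ : List S → PMF A₁}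
    {π : List S → PMF A₂} {σ' : List S → PMF A₁'} {π' : List S → PMF A₂'}
    (h : ∀ l s, G.nextPMF σ π l s = G'.nextPMF σ' π' l s) (s : S) :
    G.law σ π s = G'.law σ' π' s := by
  have : G.nextKernel σ π = G'.nextKernel σ' π' := by
    funext m
    ext x : 1
    simp only [nextKernel, Kernel.coe_mk, h]
  simp only [law, this]

theorem law_swap (G : Game S A₁ A₂) (σ : List S → PMF A₁) (π : List S → PMF A₂) (s : S) :
    G.swap.law π σ s = G.law σ π s := by
  refine law_eq_of_nextPMF_eq (fun l s => ?_) s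
  rw [nextPMF, nextPMF, PMF.bind_comm]
  rfl

/-- Exchanging the players in both games of a simulation. -/
def Simulation.swap {G : Game S A₁ A₂} {G' : Game S' A₁' A₂'} {ι : S → S'} {k : ℕ}
    (H : Simulation G G' ι k) : Simulation G.swap G'.swap ι k where
  lift₁ := H.lift₂
  lift₂ := H.lift₁
  proj₁ := H.proj₂
  proj₂ := H.proj₁
  law_lift₁ σ π' s φ hφ := by
    rw [law_swap, law_swap]; exact H.law_lift₂ π' σ s φ hφ
  law_lift₂ σ' π s φ hφ := by
    rw [law_swap, law_swap]; exact H.law_lift₁ π σ' s φ hφ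

end Simulation

theorem TurnBased.swap {S A₁ A₂ : Type} [Fintype S] {G : Game S A₁ A₂} (h : G.TurnBased) :
    G.swap.TurnBased := fun s => (h s).symm.imp (fun h _ _ _ => h _ _ _) (fun h _ _ _ => h _ _ _)

/-! ### Randomness from concurrency -/

section Determinize

variable {S A₁ A₂ A₁' A₂' : Type} [Fintype S] {N : ℕ}

open Classical in
/-- The game in which the players choose, in addition to their actions `a` and `b`, numbers `i` and
`j` modulo `N`, and the successor of `s` is `f s a b (i + j)`. If one of the players chooses the
number uniformly, then `i + j` is uniform whatever the opponent does. -/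
def determinize (G : Game S A₁ A₂) (e₁ : A₁' ≃ A₁ × Fin N) (e₂ : A₂' ≃ A₂ × Fin N)
    (f : S → A₁ → A₂ → Fin N → S) : Game S A₁' A₂' where
  δ s a b t := if f s (e₁ a).1 (e₂ b).1 ((e₁ a).2 + (e₂ b).2) = t then 1 else 0
  δ_nonneg s a b t := by split_ifs <;> norm_num
  δ_sum s a b := by simp
  obs₁ := G.obs₁
  obs₂ := G.obs₂

variable (G : Game S A₁ A₂) (e₁ : A₁' ≃ A₁ × Fin N) (e₂ : A₂' ≃ A₂ × Fin N)
    (f : S → A₁ → A₂ → Fin N → S)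

theorem determinize_deterministic : (G.determinize e₁ e₂ f).Deterministic := fun _ _ _ =>
  ⟨_, if_pos rfl⟩

theorem stepPMF_determinize (s : S) (a : A₁') (b : A₂') :
    (G.determinize e₁ e₂ f).stepPMF s a b =
      PMF.pure (f s (e₁ a).1 (e₂ b).1 ((e₁ a).2 + (e₂ b).2)) := by
  ext t
  rw [stepPMF, PMF.ofFintype_apply, PMF.pure_apply]
  simp only [determinize]
  by_cases h : f s (e₁ a).1 (e₂ b).1 ((e₁ a).2 + (e₂ b).2) = t
  · simp [h]
  · simp [h, Ne.symm h]

variable [NeZero N]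

/-- The number added to an action uniformly at random. -/
def withUniform {A A' : Type} (e : A' ≃ A × Fin N) (p : PMF A) : PMF A' :=
  p.bind fun a => (PMF.uniformOfFintype (Fin N)).map fun i => e.symm (a, i)

/-- The marginal distribution of the action. -/
def marginal {A A' : Type} (e : A' ≃ A × Fin N) (p : PMF A') : PMF A :=
  p.map fun a => (e a).1

/-- Each successor is selected by the fraction of the numbers modulo `N` that is its probability. -/
def Selects : Prop :=
  ∀ s a b t, (Nat.card {r : Fin N // f s a b r = t} : ℚ) = N * G.δ s a b t

variable {f}

/-- A uniform number selects the successor with the right distribution, also after a permutation of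
the numbers; the permutations used are the translations by the number of the opponent. -/
theorem Selects.map_uniform {G : Game S A₁ A₂} (hf : G.Selects f) (s : S) (a : A₁) (b : A₂)
    (g : Fin N ≃ Fin N) :
    (PMF.uniformOfFintype (Fin N)).map (fun i => f s a b (g i)) = G.stepPMF s a b := by
  classical
  ext t
  have hN : (N : ℝ≥0∞) ≠ 0 := by exact_mod_cast NeZero.ne N
  have hc : ((Finset.univ.filter fun i => t = f s a b (g i)).card : ℚ) = N * G.δ s a b t := by
    rw [← hf s a b t, Nat.card_eq_fintype_card, ← Fintype.card_subtype]
    congr 1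
    exact Fintype.card_congr (g.subtypeEquiv fun i => eq_comm)
  rw [PMF.map_apply, tsum_fintype, stepPMF, PMF.ofFintype_apply]
  simp only [PMF.uniformOfFintype_apply, Fintype.card_fin]
  rw [← Finset.sum_filter, Finset.sum_const, nsmul_eq_mul, ← div_eq_mul_inv,
    eq_comm, ENNReal.eq_div_iff hN (by simp)]
  have : ((Finset.univ.filter fun i => t = f s a b (g i)).card : ℝ) = N * (G.δ s a b t : ℝ) := by
    exact_mod_cast hc
  rw [← ENNReal.ofReal_natCast, ← ENNReal.ofReal_natCast, this,
    ENNReal.ofReal_mul (Nat.cast_nonneg _)]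

theorem withUniform_bind {G : Game S A₁ A₂} (hf : G.Selects f) (p : PMF A₁) (s : S) (b : A₂') :
    ((withUniform e₁ p).bind fun a => (G.determinize e₁ e₂ f).stepPMF s a b) =
      p.bind fun a => G.stepPMF s a (e₂ b).1 := by
  simp only [withUniform, PMF.bind_bind, PMF.bind_map, Function.comp_def, stepPMF_determinize,
    Equiv.apply_symm_apply]
  congr 1
  funext a
  exact hf.map_uniform s a _ (Equiv.addRight _)

theorem withUniform_bind' {G : Game S A₁ A₂} (hf : G.Selects f) (q : PMF A₂) (s : S) (a : A₁') :
    ((withUniform e₂ q).bind fun b => (G.determinize e₁ e₂ f).stepPMF s a b) =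
      q.bind fun b => G.stepPMF s (e₁ a).1 b := by
  simp only [withUniform, PMF.bind_bind, PMF.bind_map, Function.comp_def, stepPMF_determinize,
    Equiv.apply_symm_apply]
  congr 1
  funext b
  exact hf.map_uniform s _ b (Equiv.addLeft _)

theorem nextPMF_withUniform_left {G : Game S A₁ A₂} (hf : G.Selects f) (σ : List S → PMF A₁)
    (π : List S → PMF A₂') (l : List S) (s : S) :
    (G.determinize e₁ e₂ f).nextPMF (fun l => withUniform e₁ (σ l)) π l s =
      G.nextPMF σ (fun l => marginal e₂ (π l)) l s := by
  rw [nextPMF, PMF.bind_comm]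
  simp only [withUniform_bind e₁ e₂ hf]
  rw [PMF.bind_comm, nextPMF]
  simp only [marginal, PMF.bind_map, Function.comp_def]

theorem nextPMF_withUniform_right {G : Game S A₁ A₂} (hf : G.Selects f) (σ : List S → PMF A₁')
    (π : List S → PMF A₂) (l : List S) (s : S) :
    (G.determinize e₁ e₂ f).nextPMF σ (fun l => withUniform e₂ (π l)) l s =
      G.nextPMF (fun l => marginal e₁ (σ l)) π l s := by
  rw [nextPMF]
  simp only [withUniform_bind' e₁ e₂ hf]
  simp only [nextPMF, marginal, PMF.bind_map, Function.comp_def]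

variable [MeasurableSpace S] [DiscreteMeasurableSpace S]

theorem law_withUniform_left {G : Game S A₁ A₂} (hf : G.Selects f) (σ : List S → PMF A₁)
    (π : List S → PMF A₂') (s : S) :
    (G.determinize e₁ e₂ f).law (fun l => withUniform e₁ (σ l)) π s =
      G.law σ (fun l => marginal e₂ (π l)) s :=
  law_eq_of_nextPMF_eq (nextPMF_withUniform_left e₁ e₂ hf σ π) s

theorem law_withUniform_right {G : Game S A₁ A₂} (hf : G.Selects f) (σ : List S → PMF A₁')
    (π : List S → PMF A₂) (s : S) :
    (G.determinize e₁ e₂ f).law σ (fun l => withUniform e₂ (π l)) s =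
      G.law (fun l => marginal e₁ (σ l)) π s :=
  law_eq_of_nextPMF_eq (nextPMF_withUniform_right e₁ e₂ hf σ π) s

/-- Apply a map to all values of a strategy. -/
def TotalStrategy.comp {A A' : Type} {r : Setoid S} (g : PMF A → PMF A') (τ : TotalStrategy A r) :
    TotalStrategy A' r := ⟨fun l => g (τ.1 l), fun l l' h => congrArg g (τ.2 l l' h)⟩

theorem liftObjective_one {S : Type} (φ : Set (ℕ → S)) : liftObjective 1 id φ = φ := by
  ext ρ
  constructor
  · rintro ⟨ρ', h, h'⟩
    obtain rfl : ρ = ρ' := funext fun i => by simpa using h' i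
    exact h
  · exact fun h => ⟨ρ, h, fun i => by simp⟩

/-- Removing the randomness of a game by concurrent choices. -/
def simulationDeterminize {G : Game S A₁ A₂} (hf : G.Selects f) :
    Simulation G (G.determinize e₁ e₂ f) id 1 where
  lift₁ := TotalStrategy.comp (withUniform e₁)
  lift₂ := TotalStrategy.comp (withUniform e₂)
  proj₁ := TotalStrategy.comp (marginal e₁)
  proj₂ := TotalStrategy.comp (marginal e₂)
  law_lift₁ σ π' s φ _ := by
    rw [liftObjective_one]
    exact congrArg (fun μ => μ φ) (law_withUniform_left e₁ e₂ hf σ.1 π'.1 s)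
  law_lift₂ σ' π s φ _ := by
    rw [liftObjective_one]
    exact congrArg (fun μ => μ φ) (law_withUniform_right e₁ e₂ hf σ'.1 π.1 s)

end Determinize

end Game

namespace Game

/-! ### Concurrent moves in two turns -/

section SequentialPlays

variable {S A₂ S' : Type}

/-- The state of the given game that belongs to a state or to an intermediate state. -/
def baseState : S ⊕ S × A₂ → S := Sum.elim id Prod.fst

/-- A player distinguishes states from intermediate states, and otherwise sees only the observation
of the underlying state of the given game. -/
def hiddenObs (e : S' ≃ S ⊕ S × A₂) (r : Setoid S) : Setoid S' where
  r x y := (e x).isLeft = (e y).isLeft ∧ r (baseState (e x)) (baseState (e y))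
  iseqv := ⟨fun _ => ⟨rfl, r.refl' _⟩, fun h => ⟨h.1.symm, r.symm' h.2⟩,
    fun h h' => ⟨h.1.trans h'.1, r.trans' h.2 h'.2⟩⟩

variable (e : S' ≃ S ⊕ S × A₂)

theorem hiddenObs_iff (r : Setoid S) (x y : S') :
    hiddenObs e r x y ↔ (e x).isLeft = (e y).isLeft ∧ r (baseState (e x)) (baseState (e y)) :=
  Iff.rfl

/-- A state of the given game as a state of the sequential game. -/
def mainState (s : S) : S' := e.symm (.inl s)

/-- The state after Player 2 has chosen `c` in `s`. -/
def midState (s : S) (c : A₂) : S' := e.symm (.inr (s, c))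

theorem apply_mainState (s : S) : e (mainState e s) = .inl s := e.apply_symm_apply _

theorem apply_midState (s : S) (c : A₂) : e (midState e s c) = .inr (s, c) :=
  e.apply_symm_apply _

@[simp]
theorem baseState_mainState (s : S) : baseState (e (mainState e s)) = s := by
  simp [mainState, baseState]

@[simp]
theorem baseState_midState (s : S) (c : A₂) : baseState (e (midState e s c)) = s := by
  simp [midState, baseState]

/-- The states and intermediate states of a sequence of moves; a move is given by the state and the
choice of Player 2. -/
def moves (p : List (S × A₂)) : List S' := p.flatMap fun q => [mainState e q.1, midState e q.1 q.2]

theorem moves_append_singleton (p : List (S × A₂)) (s : S) (c : A₂) :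
    moves e (p ++ [(s, c)]) = moves e p ++ [mainState e s] ++ [midState e s c] := by
  simp [moves]

/-- The underlying states at the even positions. -/
def evenPart : List S' → List S
  | [] => []
  | [x] => [baseState (e x)]
  | x :: _ :: l => baseState (e x) :: evenPart l

theorem evenPart_moves (p : List (S × A₂)) : evenPart e (moves e p) = p.map Prod.fst := by
  induction p with
  | nil => rfl
  | cons q p ih =>
    rw [moves] at ih ⊢
    simp [evenPart, ih]

theorem evenPart_moves_append (p : List (S × A₂)) (s : S) :
    evenPart e (moves e p ++ [mainState e s]) = p.map Prod.fst ++ [s] := by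
  induction p with
  | nil => simp [moves, evenPart]
  | cons q p ih =>
    rw [moves] at ih ⊢
    simp only [List.flatMap_cons, List.cons_append, List.nil_append, evenPart, ih, List.map_cons,
      baseState_mainState]

/-- The sequence of the states that are underlying at the even times. -/
def evenPlay (ρ : ℕ → S') (i : ℕ) : S := baseState (e (ρ (2 * i)))

theorem evenPart_prefix (ρ : ℕ → S') (m : ℕ) :
    evenPart e ((List.range (2 * m)).map ρ) = (List.range m).map (evenPlay e ρ) := by
  induction m generalizing ρ with
  | zero => rfl
  | succ m ih =>
    have h := ih (fun i => ρ (i + 2))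
    rw [show 2 * (m + 1) = 2 * m + 1 + 1 by ring, List.range_succ_eq_map, List.range_succ_eq_map,
      List.range_succ_eq_map]
    simp only [List.map_cons, List.map_map, evenPart, evenPlay]
    congr 1

theorem evenPart_sameObs {r : Setoid S} {r' : Setoid S'}
    (hr : ∀ x y, r' x y → r (baseState (e x)) (baseState (e y))) :
    ∀ {l l' : List S'}, SameObs r' l l' → SameObs r (evenPart e l) (evenPart e l')
  | [], _, h => by cases h; exact .nil
  | [x], _, h => by
    rcases h with _ | ⟨h, h'⟩
    cases h'
    exact .cons (hr _ _ h) .nil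
  | x :: y :: l, _, h => by
    rcases h with _ | ⟨h, h'⟩
    rcases h' with _ | ⟨h', h''⟩
    exact .cons (hr _ _ h) (evenPart_sameObs hr h'')

end SequentialPlays

section Sequentialize

variable {S A₁ A₂ S' : Type} [Fintype S] [Fintype S']

open Classical in
/-- The transitions between states and intermediate states. -/
def seqδ (G : Game S A₁ A₂) : S ⊕ S × A₂ → A₁ → A₂ → S ⊕ S × A₂ → ℚ
  | .inl s, _, c, y => if y = .inr (s, c) then 1 else 0
  | .inr (s, c), d, _, .inl t => G.δ s d c t
  | .inr _, _, _, .inr _ => 0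

/-- The game in which every move of `G` is made in two turns: in `s` Player 2 chooses an action `c`,
which leads to the intermediate state `(s, c)`; there Player 1, who sees only the observation of
`s`, chooses an action. Player 2 sees his choice if and only if `vis` holds. -/
def sequentialize [Fintype A₂] (G : Game S A₁ A₂) (e : S' ≃ S ⊕ S × A₂) (vis : Bool) :
    Game S' A₁ A₂ where
  δ x d c y := G.seqδ (e x) d c (e y)
  δ_nonneg x d c y := by
    unfold seqδ
    split
    · split_ifs <;> norm_num
    · exact G.δ_nonneg _ _ _ _
    · exact le_rfl
  δ_sum x d c := by
    rw [e.sum_comp (fun y => G.seqδ (e x) d c y)]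
    rcases e x with s | ⟨s, b⟩
    · simp [seqδ]
    · simp [seqδ, G.δ_sum]
  obs₁ := hiddenObs e G.obs₁
  obs₂ := if vis then ⊥ else hiddenObs e G.obs₂

variable [Fintype A₂] (G : Game S A₁ A₂) (e : S' ≃ S ⊕ S × A₂) (vis : Bool)

theorem sequentialize_turnBased : (G.sequentialize e vis).TurnBased := by
  intro x
  rcases h : e x with s | ⟨s, b⟩
  · exact .inr fun a a' b => by simp only [sequentialize, h, seqδ]
  · refine .inl fun a b b' => ?_
    funext y
    simp only [sequentialize, h]
    rcases e y with t | t <;> rfl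

variable {G} in
theorem Deterministic.sequentialize (hG : G.Deterministic) :
    (G.sequentialize e vis).Deterministic := by
  intro x d c
  rcases h : e x with s | ⟨s, b⟩
  · exact ⟨e.symm (.inr (s, c)), by simp [Game.sequentialize, h, seqδ]⟩
  · obtain ⟨t, ht⟩ := hG s d b
    exact ⟨e.symm (.inl t), by simp [Game.sequentialize, h, seqδ, ht]⟩

theorem sequentialize_oneSided : (G.sequentialize e true).OneSided :=
  .inr fun x y h => by
    exact (show (⊥ : Setoid S') x y from h)

/-- The distribution of the successor if Player 1 mixes his actions by `p`. -/
def mixedStep (p : PMF A₁) (s : S) (c : A₂) : PMF S := p.bind fun d => G.stepPMF s d c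

theorem stepPMF_mainState (s : S) (d : A₁) (c : A₂) :
    (G.sequentialize e vis).stepPMF (mainState e s) d c = PMF.pure (midState e s c) := by
  ext y
  rw [stepPMF, PMF.ofFintype_apply, PMF.pure_apply]
  have : e y = .inr (s, c) ↔ y = midState e s c := e.eq_symm_apply.symm
  simp only [sequentialize, apply_mainState, seqδ]
  by_cases h : y = midState e s c
  · rw [if_pos h, if_pos (this.2 h)]
    simp
  · rw [if_neg h, if_neg (fun h' => h (this.1 h'))]
    simp

theorem stepPMF_midState (s : S) (d : A₁) (c c' : A₂) :
    (G.sequentialize e vis).stepPMF (midState e s c) d c' =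
      (G.stepPMF s d c).map (mainState e) := by
  ext y
  rw [stepPMF, PMF.ofFintype_apply, PMF.map_apply, tsum_fintype]
  have hy (t : S) : y = mainState e t ↔ e y = .inl t := e.eq_symm_apply
  simp only [sequentialize, apply_midState]
  rcases h : e y with t | t
  · rw [Finset.sum_eq_single t, if_pos ((hy t).2 h)]
    · rfl
    · exact fun b _ hb => if_neg fun h' => hb (Sum.inl_injective (((hy b).1 h').symm.trans h))
    · simp
  · rw [Finset.sum_eq_zero fun b _ => if_neg fun h' => by simp [(hy b).1 h'] at h]
    simp [seqδ]

theorem nextPMF_mainState (σ : List S' → PMF A₁) (π : List S' → PMF A₂) (l : List S') (s : S) :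
    (G.sequentialize e vis).nextPMF σ π l (mainState e s) = (π l).map (midState e s) := by
  simp only [nextPMF, stepPMF_mainState, PMF.bind_const]
  rfl

theorem nextPMF_midState (σ : List S' → PMF A₁) (π : List S' → PMF A₂) (l : List S') (s : S)
    (c : A₂) : (G.sequentialize e vis).nextPMF σ π l (midState e s c) =
      (G.mixedStep (σ l) s c).map (mainState e) := by
  simp only [nextPMF, stepPMF_midState, PMF.bind_const, mixedStep, PMF.map_bind]

theorem sum_map_mul {X Y : Type} [Fintype X] [Fintype Y] (p : PMF X) (g : X → Y) (F : Y → ℝ≥0∞) :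
    ∑ y, p.map g y * F y = ∑ x, p x * F (g x) := by
  classical
  simp only [PMF.map_apply, tsum_fintype, Finset.sum_mul, ite_mul, zero_mul]
  rw [Finset.sum_comm]
  refine Finset.sum_congr rfl fun x _ => ?_
  simp

/-- Two turns make up one move. -/
theorem stepMean_stepMean (σ : List S' → PMF A₁) (π : List S' → PMF A₂)
    (g : List S' → S' → ℝ≥0∞) (p : List (S × A₂)) (s : S) :
    (G.sequentialize e vis).stepMean σ π ((G.sequentialize e vis).stepMean σ π g) (moves e p)
      (mainState e s) = ∑ c, π (moves e p ++ [mainState e s]) c *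
        ∑ t, G.mixedStep (σ (moves e (p ++ [(s, c)]))) s c t *
          g (moves e (p ++ [(s, c)])) (mainState e t) := by
  rw [stepMean, nextPMF_mainState, sum_map_mul]
  refine Finset.sum_congr rfl fun c _ => ?_
  rw [stepMean, nextPMF_midState, sum_map_mul, moves_append_singleton]

theorem nextPMF_apply_mixedStep (σ : List S → PMF A₁) (π : List S → PMF A₂) (l : List S)
    (s t : S) : G.nextPMF σ π l s t = ∑ c, π l c * G.mixedStep (σ l) s c t := by
  rw [nextPMF, PMF.bind_comm, PMF.bind_apply, tsum_fintype]
  rfl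

/-- The raw strategies `σ'`, `π'` of the sequential game give the histories of the given game the
same means as `σ`, `π`. -/
def SameMeans (σ' : List S' → PMF A₁) (π' : List S' → PMF A₂) (σ : List S → PMF A₁)
    (π : List S → PMF A₂) : Prop :=
  ∀ (s : S) (m : ℕ) (g : List S' → S' → ℝ≥0∞) (F : List S → S → ℝ≥0∞),
    (∀ p s, g (moves e p) (mainState e s) = F (p.map Prod.fst) s) →
      (G.sequentialize e vis).prefixMean σ' π' (mainState e s) (2 * m) g =
        G.prefixMean σ π s m F

variable [MeasurableSpace S] [DiscreteMeasurableSpace S] [MeasurableSpace S']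
  [DiscreteMeasurableSpace S']

variable {G e vis} in
/-- Almost surely the even positions carry states of the given game, so the lifted objective has the
probability of `φ` under the law of the states at even positions. -/
theorem SameMeans.law_liftObjective {σ' : List S' → PMF A₁} {π' : List S' → PMF A₂}
    {σ : List S → PMF A₁} {π : List S → PMF A₂} (h : G.SameMeans e vis σ' π' σ π) (s : S)
    {φ : Set (ℕ → S)} (hφ : MeasurableSet φ) :
    (G.sequentialize e vis).law σ' π' (mainState e s) (liftObjective 2 (mainState e) φ) =
      G.law σ π s φ := by
  classical
  have hmeas : Measurable (evenPlay e) := by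
    refine measurable_pi_lambda _ fun i => ?_
    exact (Measurable.of_discrete (f := fun x => baseState (e x))).comp
      (measurable_pi_apply (X := fun _ => S') (2 * i))
  have hmap : ((G.sequentialize e vis).law σ' π' (mainState e s)).map (evenPlay e) =
      G.law σ π s := by
    have : IsProbabilityMeasure (((G.sequentialize e vis).law σ' π' (mainState e s)).map
        (evenPlay e)) := Measure.isProbabilityMeasure_map hmeas.aemeasurable
    refine measure_ext_of_prefix fun n F => ?_
    have hF : Measurable fun ρ : ℕ → S => F ((List.range n).map ρ) (ρ n) := by
      simp only [← onHist_frestrictLe]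
      exact (Measurable.of_discrete (f := onHist F n)).comp
        (Preorder.measurable_frestrictLe (X := fun _ => S) n)
    rw [lintegral_map hF hmeas, lintegral_law,
      ← h s n (fun l x => F (evenPart e l) (baseState (e x))) F, ← lintegral_law]
    · simp only [evenPart_prefix]
      rfl
    · intro p t
      simp [evenPart_moves]
  have hae : ∀ᵐ ρ ∂((G.sequentialize e vis).law σ' π' (mainState e s)),
      ∀ i, ρ (2 * i) ∈ Set.range (mainState e : S → S') := by
    rw [ae_all_iff]
    intro i
    have hm : MeasurableSet {ρ : ℕ → S' | ρ (2 * i) ∈ Set.range (mainState e : S → S')} :=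
      measurable_pi_apply (X := fun _ => S') (2 * i)
        (MeasurableSet.of_discrete (s := Set.range (mainState e)))
    refine (prob_compl_eq_zero_iff
      (μ := (G.sequentialize e vis).law σ' π' (mainState e s)) hm).2 ?_
    rw [← lintegral_indicator_one hm]
    have h₁ := h s i (fun _ x => if x ∈ Set.range (mainState e : S → S') then 1 else 0)
      (fun _ _ => 1) (fun p t => if_pos ⟨t, rfl⟩)
    rw [prefixMean_one, ← lintegral_law] at h₁
    rw [← h₁]
    refine lintegral_congr fun ρ => ?_
    simp [Set.indicator_apply]
  rw [← hmap, Measure.map_apply hmeas hφ]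
  refine measure_congr ?_
  filter_upwards [hae] with ρ hρ
  refine propext ⟨?_, fun hφ' => ⟨evenPlay e ρ, hφ', fun i => ?_⟩⟩
  · rintro ⟨ρ₀, h₀, h₁⟩
    have : evenPlay e ρ = ρ₀ := funext fun i => by
      simp [evenPlay, h₁]
    change evenPlay e ρ ∈ φ
    rwa [this]
  · obtain ⟨t, ht⟩ := hρ i
    simp [evenPlay, ← ht]

end Sequentialize

end Game

namespace Game

/-! ### Translating strategies that do not see the intermediate states -/

section Hidden

variable {S A₁ A₂ S' : Type} (e : S' ≃ S ⊕ S × A₂)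

/-- A strategy that ignores the intermediate states. -/
def liftSeq {A : Type} (τ : List S → PMF A) (l : List S') : PMF A := τ (evenPart e l)

theorem liftSeq_sameObs {A : Type} {r : Setoid S} {r' : Setoid S'}
    (hr : ∀ x y, r' x y → r (baseState (e x)) (baseState (e y))) (τ : TotalStrategy A r)
    (l l' : List S') (h : SameObs r' l l') : liftSeq e τ.1 l = liftSeq e τ.1 l' :=
  τ.2 _ _ (evenPart_sameObs e hr h)

/-- The history with the states `l` along which Player 2 always chooses `c₀`; to a player who does
not see the choices it looks like every other history with these states. -/
def constMoves (c₀ : A₂) (l : List S) : List S' := moves e (l.map fun s => (s, c₀))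

variable {e} in
theorem hiddenObs_mainState {r : Setoid S} {s t : S} (h : r s t) :
    hiddenObs e r (mainState e s) (mainState e t) := by
  refine ⟨by rw [apply_mainState, apply_mainState]; rfl, ?_⟩
  rwa [baseState_mainState, baseState_mainState]

variable {e} in
theorem hiddenObs_midState {r : Setoid S} {s t : S} (h : r s t) (c d : A₂) :
    hiddenObs e r (midState e s c) (midState e t d) := by
  refine ⟨by rw [apply_midState, apply_midState]; rfl, ?_⟩
  rwa [baseState_midState, baseState_midState]

theorem sameObs_moves {r : Setoid S} {p q : List (S × A₂)}
    (h : SameObs r (p.map Prod.fst) (q.map Prod.fst)) :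
    SameObs (hiddenObs e r) (moves e p) (moves e q) := by
  induction p generalizing q with
  | nil =>
    cases q with
    | nil => exact .nil
    | cons _ _ => cases h
  | cons a p ih =>
    cases q with
    | nil => cases h
    | cons b q =>
      rcases h with _ | ⟨h, h'⟩
      exact .cons (hiddenObs_mainState h) (.cons (hiddenObs_midState h _ _) (ih h'))

theorem sameObs_constMoves {r : Setoid S} (c₀ : A₂) {l l' : List S} (h : SameObs r l l') :
    SameObs (hiddenObs e r) (constMoves e c₀ l) (constMoves e c₀ l') :=
  sameObs_moves e (by simpa [Function.comp_def] using h)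

theorem SameObs.dropLast {S : Type} {r : Setoid S} {l l' : List S} (h : SameObs r l l') :
    SameObs r l.dropLast l'.dropLast := by
  have h' : l.length = l'.length := List.Forall₂.length_eq h
  rw [List.dropLast_eq_take, List.dropLast_eq_take, h']
  exact List.forall₂_take _ h

theorem sameObs_moves_constMoves (r : Setoid S) (c₀ : A₂) (p : List (S × A₂)) :
    SameObs (hiddenObs e r) (moves e p) (constMoves e c₀ (p.map Prod.fst)) :=
  sameObs_moves e (by simpa [Function.comp_def] using SameObs.refl r _)

theorem sameObs_moves_dropLast (r : Setoid S) (c₀ : A₂) (p : List (S × A₂)) (s : S) :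
    SameObs (hiddenObs e r) (moves e p ++ [mainState e s])
      (constMoves e c₀ (p.map Prod.fst ++ [s])).dropLast := by
  have := (sameObs_moves_constMoves e r c₀ (p ++ [(s, c₀)])).dropLast
  rwa [moves_append_singleton, List.dropLast_concat, List.map_append] at this

variable [Fintype S] [Fintype S'] [Fintype A₂] (G : Game S A₁ A₂) (vis : Bool)

theorem sameMeans_of_eq {σ' : List S' → PMF A₁} {π' : List S' → PMF A₂} {σ : List S → PMF A₁}
    {π : List S → PMF A₂}
    (hσ : ∀ p s c, σ' (moves e (p ++ [(s, c)])) = σ (p.map Prod.fst ++ [s]))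
    (hπ : ∀ p s, π' (moves e p ++ [mainState e s]) = π (p.map Prod.fst ++ [s])) :
    G.SameMeans e vis σ' π' σ π := by
  intro s₀ m
  induction m with
  | zero => exact fun g F h => h [] s₀
  | succ m ih =>
    intro g F h
    refine ih _ _ fun p s => ?_
    rw [stepMean_stepMean, stepMean]
    simp only [hσ, hπ, h, List.map_append, List.map_cons, List.map_nil, nextPMF_apply_mixedStep,
      Finset.mul_sum, Finset.sum_mul]
    rw [Finset.sum_comm]
    simp only [mul_assoc]

end Hidden

/-! ### Translating a strategy of a player who sees all intermediate states -/

section Visible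

variable {S A₁ A₂ S' : Type} [Fintype A₂] (e : S' ≃ S ⊕ S × A₂)
  (u : S → A₂ → S → ℝ≥0∞) (π' : List S' → PMF A₂)

/-- The sum of `g` over the choices that Player 2 may have made along the history that ends in `s`
after the states `l` (the last one first), weighted by their probabilities under `π'` and by the
factors `u`. -/
def choiceSum : List S → S → (List (S × A₂) → ℝ≥0∞) → ℝ≥0∞
  | [], _, g => g []
  | s' :: l, s, g => choiceSum l s' fun p =>
      ∑ c, π' (moves e p ++ [mainState e s']) c * (u s' c s * g (p ++ [(s', c)]))

variable {u π'}

theorem choiceSum_congr {l : List S} {s : S} {g g' : List (S × A₂) → ℝ≥0∞}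
    (h : ∀ p, p.map Prod.fst = l.reverse → g p = g' p) :
    choiceSum e u π' l s g = choiceSum e u π' l s g' := by
  induction l generalizing s g g' with
  | nil => exact h [] rfl
  | cons s' l ih =>
    refine ih fun p hp => Finset.sum_congr rfl fun c _ => ?_
    rw [h _ (by simp [hp])]

theorem choiceSum_sum {X : Type} (I : Finset X) (l : List S) (s : S)
    (g : X → List (S × A₂) → ℝ≥0∞) :
    choiceSum e u π' l s (fun p => ∑ x ∈ I, g x p) = ∑ x ∈ I, choiceSum e u π' l s (g x) := by
  induction l generalizing s g with
  | nil => rfl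
  | cons s' l ih =>
    simp only [choiceSum]
    rw [← ih]
    congr 1
    funext p
    rw [Finset.sum_comm]
    simp only [Finset.mul_sum]

theorem choiceSum_const_mul (k : ℝ≥0∞) (l : List S) (s : S) (g : List (S × A₂) → ℝ≥0∞) :
    choiceSum e u π' l s (fun p => k * g p) = k * choiceSum e u π' l s g := by
  induction l generalizing s g with
  | nil => rfl
  | cons s' l ih =>
    simp only [choiceSum]
    rw [← ih]
    congr 1
    funext p
    rw [Finset.mul_sum]
    refine Finset.sum_congr rfl fun c _ => ?_
    ring

theorem choiceSum_mono {l : List S} {s : S} {g g' : List (S × A₂) → ℝ≥0∞} (h : ∀ p, g p ≤ g' p) :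
    choiceSum e u π' l s g ≤ choiceSum e u π' l s g' := by
  induction l generalizing s g g' with
  | nil => exact h _
  | cons s' l ih =>
    refine ih fun p => Finset.sum_le_sum fun c _ => ?_
    gcongr
    exact h _

theorem choiceSum_ne_top (hu : ∀ s c t, u s c t ≠ ⊤) {l : List S} {s : S}
    {g : List (S × A₂) → ℝ≥0∞} (h : ∀ p, g p ≠ ⊤) : choiceSum e u π' l s g ≠ ⊤ := by
  induction l generalizing s g with
  | nil => exact h _
  | cons s' l ih =>
    refine ih fun p => ENNReal.sum_ne_top.2 fun c _ => ?_
    exact ENNReal.mul_ne_top (PMF.apply_ne_top _ _) (ENNReal.mul_ne_top (hu _ _ _) (h _))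

variable (u π') in
/-- The total weight of all choices of Player 2. -/
def weight (l : List S) (s : S) : ℝ≥0∞ := choiceSum e u π' l s fun _ => 1

theorem choiceSum_eq_zero {l : List S} {s : S} (h : weight e u π' l s = 0)
    (g : List (S × A₂) → ℝ≥0∞) : choiceSum e u π' l s g = 0 := by
  refine le_antisymm ?_ bot_le
  calc choiceSum e u π' l s g ≤ choiceSum e u π' l s (fun _ => ⊤ * 1) :=
        choiceSum_mono e fun p => by simp
    _ = ⊤ * weight e u π' l s := choiceSum_const_mul e _ _ _ _
    _ = 0 := by rw [h, mul_zero]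

/-- The weight of the choices for which Player 2 chooses `c` next. -/
def nextWeight (π' : List S' → PMF A₂) (u : S → A₂ → S → ℝ≥0∞) (l : List S) (s : S) (c : A₂) :
    ℝ≥0∞ :=
  choiceSum e u π' l s fun p => π' (moves e p ++ [mainState e s]) c

theorem sum_nextWeight (l : List S) (s : S) :
    ∑ c, nextWeight e π' u l s c = weight e u π' l s := by
  simp only [nextWeight, ← choiceSum_sum]
  congr 1
  funext p
  rw [← tsum_fintype (L := .unconditional A₂), PMF.tsum_coe]

theorem weight_cons (l : List S) (s t : S) :
    weight e u π' (s :: l) t = ∑ c, nextWeight e π' u l s c * u s c t := by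
  simp only [weight, choiceSum, nextWeight, choiceSum_sum]
  refine Finset.sum_congr rfl fun c _ => ?_
  rw [mul_comm _ (u s c t), ← choiceSum_const_mul]
  congr 1
  funext p
  ring

variable (π') in
open Classical in
/-- The strategy that chooses an action with the probability that `π'` chooses it, given the
states of the history. -/
def averaged (hu : ∀ s c t, u s c t ≠ ⊤) (l : List S) : PMF A₂ :=
  match l.reverse with
  | [] => π' []
  | s :: l =>
    if h : weight e u π' l s = 0 then π' []
    else PMF.normalize (nextWeight e π' u l s)
      (by rw [tsum_fintype, sum_nextWeight]; exact h)
      (by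
        rw [tsum_fintype, sum_nextWeight]
        exact choiceSum_ne_top e hu fun _ => ENNReal.one_ne_top)

theorem averaged_apply (hu : ∀ s c t, u s c t ≠ ⊤) (l : List S) (s : S)
    (h : weight e u π' l.reverse s ≠ 0) (c : A₂) :
    averaged e π' hu (l ++ [s]) c =
      nextWeight e π' u l.reverse s c * (weight e u π' l.reverse s)⁻¹ := by
  have hl : (l ++ [s]).reverse = s :: l.reverse := by simp
  unfold averaged
  split
  · simp_all
  · next s₁ l₁ h₁ =>
    rw [hl] at h₁
    obtain ⟨rfl, rfl⟩ := List.cons_eq_cons.1 h₁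
    rw [dif_neg h, PMF.normalize_apply, tsum_fintype, sum_nextWeight]

variable [Fintype S] (G : Game S A₁ A₂)

/-- The decisive property of turn-based moves: the probability of a move factors into a part `u`
that does not depend on the strategy `σ` of Player 1 and a part `v` that does not depend on the
choice `c` of Player 2. -/
def Factors (u : S → A₂ → S → ℝ≥0∞) (v : List S → S → S → ℝ≥0∞) (σ : List S → PMF A₁) : Prop :=
  ∀ l s c t, G.mixedStep (σ (l ++ [s])) s c t = v l s t * u s c t

variable {G e} {v : List S → S → S → ℝ≥0∞} {σ : List S → PMF A₁} {σ' : List S' → PMF A₁}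

theorem nextPMF_averaged (hu : ∀ s c t, u s c t ≠ ⊤) (hv : G.Factors u v σ) (l : List S) (s t : S)
    (h : weight e u π' l.reverse s ≠ 0) :
    G.nextPMF σ (averaged e π' hu) (l ++ [s]) s t =
      v l s t * ((weight e u π' l.reverse s)⁻¹ * weight e u π' (s :: l.reverse) t) := by
  rw [nextPMF_apply_mixedStep, weight_cons, Finset.mul_sum, Finset.mul_sum]
  refine Finset.sum_congr rfl fun c _ => ?_
  rw [hv, averaged_apply e hu l s h]
  ring

variable [Fintype S'] (vis : Bool)

/-- The means under `π'` are means under the averaged strategy of conditional means over the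
choices. The factors `v` of Player 1 cancel in the conditional means. -/
theorem prefixMean_averaged (hu : ∀ s c t, u s c t ≠ ⊤) (hv : G.Factors u v σ)
    (hσ : ∀ p s c, σ' (moves e (p ++ [(s, c)])) = σ (p.map Prod.fst ++ [s])) (s₀ : S) (m : ℕ)
    (g : List S' → S' → ℝ≥0∞) :
    (G.sequentialize e vis).prefixMean σ' π' (mainState e s₀) (2 * m) g =
      G.prefixMean σ (averaged e π' hu) s₀ m fun l s => (weight e u π' l.reverse s)⁻¹ *
        choiceSum e u π' l.reverse s fun p => g (moves e p) (mainState e s) := by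
  induction m generalizing g with
  | zero => simp [prefixMean, choiceSum, weight, moves]
  | succ m ih =>
    rw [show 2 * (m + 1) = 2 * m + 1 + 1 by ring, prefixMean, prefixMean, ih, prefixMean]
    congr 1
    funext l s
    have hsum : (choiceSum e u π' l.reverse s fun p =>
        (G.sequentialize e vis).stepMean σ' π' ((G.sequentialize e vis).stepMean σ' π' g)
          (moves e p) (mainState e s)) =
        ∑ t, v l s t * choiceSum e u π' (s :: l.reverse) t fun p =>
          g (moves e p) (mainState e t) := by
      simp only [choiceSum, ← choiceSum_const_mul, ← choiceSum_sum]
      refine choiceSum_congr e fun p hp => ?_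
      rw [List.reverse_reverse] at hp
      rw [stepMean_stepMean]
      simp only [hσ, hp, hv l, Finset.mul_sum]
      rw [Finset.sum_comm]
      refine Finset.sum_congr rfl fun t _ => Finset.sum_congr rfl fun c _ => ?_
      ring
    rw [hsum, stepMean, Finset.mul_sum]
    refine Finset.sum_congr rfl fun t _ => ?_
    rw [List.reverse_append, List.reverse_singleton, List.singleton_append]
    by_cases h : weight e u π' l.reverse s = 0
    · have h₁ : ∀ g, choiceSum e u π' (s :: l.reverse) t g = 0 :=
        fun g => choiceSum_eq_zero e h _
      rw [h₁]
      simp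
    rw [nextPMF_averaged hu hv l s t h]
    by_cases h₁ : weight e u π' (s :: l.reverse) t = 0
    · rw [choiceSum_eq_zero e h₁]
      simp
    · have h₂ : weight e u π' (s :: l.reverse) t ≠ ⊤ :=
        choiceSum_ne_top e hu fun _ => ENNReal.one_ne_top
      calc _ = (v l s t * (weight e u π' l.reverse s)⁻¹ *
            choiceSum e u π' (s :: l.reverse) t fun p => g (moves e p) (mainState e t)) *
            1 := by ring
        _ = _ := by
            rw [← ENNReal.mul_inv_cancel h₁ h₂]
            ring

theorem sameMeans_averaged (hu : ∀ s c t, u s c t ≠ ⊤) (hv : G.Factors u v σ)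
    (hσ : ∀ p s c, σ' (moves e (p ++ [(s, c)])) = σ (p.map Prod.fst ++ [s])) :
    G.SameMeans e vis σ' π' σ (averaged e π' hu) := by
  intro s₀ m g F hF
  rw [prefixMean_averaged vis hu hv hσ]
  refine G.prefixMean_congr _ _ (fun l s => weight e u π' l.reverse s ≠ 0) ?_ ?_ m ?_
  · simp [weight, choiceSum]
  · intro l s t h ht ht'
    rw [List.reverse_append, List.reverse_singleton, List.singleton_append] at ht'
    rw [nextPMF_averaged hu hv l s t h, ht'] at ht
    simp at ht
  · intro l s h
    have h₂ : weight e u π' l.reverse s ≠ ⊤ :=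
      choiceSum_ne_top e hu fun _ => ENNReal.one_ne_top
    have : (choiceSum e u π' l.reverse s fun p => g (moves e p) (mainState e s)) =
        F l s * weight e u π' l.reverse s := by
      rw [weight, ← choiceSum_const_mul]
      refine choiceSum_congr e fun p hp => ?_
      rw [hF, hp, List.reverse_reverse, mul_one]
    rw [this, mul_comm, mul_assoc, ENNReal.mul_inv_cancel h h₂, mul_one]

end Visible

/-! ### The deterministic sequential game -/

section Combined

variable {S A₁ A₂ A₁' A₂' S' : Type} [Fintype S] {N : ℕ} [NeZero N]
  {G : Game S A₁ A₂} (e₁ : A₁' ≃ A₁ × Fin N) (e₂ : A₂' ≃ A₂ × Fin N)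
  {f : S → A₁ → A₂ → Fin N → S} (e : S' ≃ S ⊕ S × A₂')

theorem mixedStep_withUniform (hf : G.Selects f) (p : PMF A₁) (s : S) (c : A₂') :
    (G.determinize e₁ e₂ f).mixedStep (withUniform e₁ p) s c = G.mixedStep p s (e₂ c).1 :=
  withUniform_bind e₁ e₂ hf p s c

theorem base_of_obs₁ [Fintype S'] [Fintype A₂'] {G : Game S A₁' A₂'} (vis : Bool) (x y : S')
    (h : (G.sequentialize e vis).obs₁ x y) : G.obs₁ (baseState (e x)) (baseState (e y)) := h.2

theorem base_of_obs₂ [Fintype S'] [Fintype A₂'] {G : Game S A₁' A₂'} (vis : Bool) (x y : S')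
    (h : (G.sequentialize e vis).obs₂ x y) : G.obs₂ (baseState (e x)) (baseState (e y)) := by
  cases vis
  · exact h.2
  · obtain rfl : x = y := h
    exact G.obs₂.refl' _

open Classical in
/-- The part of the probability of a move that depends on the action of Player 2. -/
def factor₂ (G : Game S A₁ A₂) (a₀ : A₁) (s : S) (b : A₂) (t : S) : ℝ≥0∞ :=
  if G.IsPlayer1State s then 1 else G.stepPMF s a₀ b t

open Classical in
/-- The part of the probability of a move that depends on the strategy of Player 1. -/
def factor₁ (G : Game S A₁ A₂) (b₀ : A₂) (σ : List S → PMF A₁) (l : List S) (s t : S) : ℝ≥0∞ :=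
  if G.IsPlayer1State s then G.mixedStep (σ (l ++ [s])) s b₀ t else 1

theorem factor₂_ne_top (a₀ : A₁) (s : S) (b : A₂) (t : S) : G.factor₂ a₀ s b t ≠ ⊤ := by
  unfold factor₂
  split_ifs
  · exact ENNReal.one_ne_top
  · exact PMF.apply_ne_top _ _

theorem TurnBased.mixedStep_eq (hG : G.TurnBased) (a₀ : A₁) (b₀ : A₂) (σ : List S → PMF A₁)
    (l : List S) (s : S) (b : A₂) (t : S) :
    G.mixedStep (σ (l ++ [s])) s b t = G.factor₁ b₀ σ l s t * G.factor₂ a₀ s b t := by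
  by_cases hs : G.IsPlayer1State s
  · rw [factor₁, factor₂, if_pos hs, if_pos hs, mul_one]
    simp only [mixedStep, stepPMF, hs _ b b₀]
  · have hs₂ := (hG s).resolve_left hs
    rw [factor₁, factor₂, if_neg hs, if_neg hs, one_mul]
    have h (a : A₁) : G.stepPMF s a b = G.stepPMF s a₀ b := by
      simp only [stepPMF, hs₂ a a₀ b]
    simp only [mixedStep, h, PMF.bind_const]

variable [Fintype S'] [Fintype A₂'] [MeasurableSpace S] [DiscreteMeasurableSpace S]
  [MeasurableSpace S'] [DiscreteMeasurableSpace S']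

/-- If no player sees the choices of Player 2, then the game is simulated by its sequential form,
whatever information the players have. -/
def simulationHidden (hf : G.Selects f) (c₀ : A₂') :
    Simulation G ((G.determinize e₁ e₂ f).sequentialize e false) (mainState e) 2 where
  lift₁ σ := ⟨liftSeq e fun l => withUniform e₁ (σ.1 l),
    liftSeq_sameObs e (base_of_obs₁ (G := G.determinize e₁ e₂ f) e false)
      (TotalStrategy.comp (r := G.obs₁) (withUniform e₁) σ)⟩
  lift₂ π := ⟨liftSeq e fun l => withUniform e₂ (π.1 l),
    liftSeq_sameObs e (base_of_obs₂ (G := G.determinize e₁ e₂ f) e false)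
      (TotalStrategy.comp (r := G.obs₂) (withUniform e₂) π)⟩
  proj₁ σ' := ⟨fun l => marginal e₁ (σ'.1 (constMoves e c₀ l)), fun l l' h =>
    congrArg _ (σ'.2 _ _ (sameObs_constMoves e c₀ h))⟩
  proj₂ π' := ⟨fun l => marginal e₂ (π'.1 (constMoves e c₀ l).dropLast), fun l l' h =>
    congrArg _ (π'.2 _ _ (sameObs_constMoves e c₀ h).dropLast)⟩
  law_lift₁ σ π' s φ hφ := by
    rw [SameMeans.law_liftObjective (sameMeans_of_eq e _ false
      (σ := fun l => withUniform e₁ (σ.1 l))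
      (π := fun l => π'.1 (constMoves e c₀ l).dropLast) ?_ ?_) s hφ,
      law_withUniform_left e₁ e₂ hf]
    · intro p s c
      simp [liftSeq, evenPart_moves]
    · intro p s
      exact π'.2 _ _ (sameObs_moves_dropLast e G.obs₂ c₀ p s)
  law_lift₂ σ' π s φ hφ := by
    rw [SameMeans.law_liftObjective (sameMeans_of_eq e _ false
      (σ := fun l => σ'.1 (constMoves e c₀ l))
      (π := fun l => withUniform e₂ (π.1 l)) ?_ ?_) s hφ,
      law_withUniform_right e₁ e₂ hf]
    · intro p s c
      rw [show p.map Prod.fst ++ [s] = (p ++ [(s, c)]).map Prod.fst by simp]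
      exact σ'.2 _ _ (sameObs_moves_constMoves e G.obs₁ c₀ _)
    · intro p s
      simp [liftSeq, evenPart_moves_append]

/-- If Player 2 has complete observation, then a turn-based game is simulated by its sequential
form in which he sees his own choices. -/
def simulationVisible (hf : G.Selects f) (hG : G.TurnBased) (hobs : CompleteObs G.obs₂)
    (a₀ : A₁) (b₀ : A₂) (c₀ : A₂') :
    Simulation G ((G.determinize e₁ e₂ f).sequentialize e true) (mainState e) 2 where
  lift₁ σ := ⟨liftSeq e fun l => withUniform e₁ (σ.1 l),
    liftSeq_sameObs e (base_of_obs₁ (G := G.determinize e₁ e₂ f) e true)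
      (TotalStrategy.comp (r := G.obs₁) (withUniform e₁) σ)⟩
  lift₂ π := ⟨liftSeq e fun l => withUniform e₂ (π.1 l),
    liftSeq_sameObs e (base_of_obs₂ (G := G.determinize e₁ e₂ f) e true)
      (TotalStrategy.comp (r := G.obs₂) (withUniform e₂) π)⟩
  proj₁ σ' := ⟨fun l => marginal e₁ (σ'.1 (constMoves e c₀ l)), fun l l' h =>
    congrArg _ (σ'.2 _ _ (sameObs_constMoves e c₀ h))⟩
  proj₂ π' := ⟨fun l => marginal e₂ (averaged e π'.1 (u := fun s c t => G.factor₂ a₀ s (e₂ c).1 t)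
    (fun _ _ _ => factor₂_ne_top _ _ _ _) l), fun l l' h => by rw [h.eq hobs]⟩
  law_lift₁ σ π' s φ hφ := by
    rw [SameMeans.law_liftObjective (sameMeans_averaged (σ := fun l => withUniform e₁ (σ.1 l))
      (v := G.factor₁ b₀ σ.1) true
      (fun s c t => factor₂_ne_top (G := G) a₀ s (e₂ c).1 t) ?_ ?_) s hφ,
      law_withUniform_left e₁ e₂ hf]
    · intro l s c t
      rw [mixedStep_withUniform e₁ e₂ hf, hG.mixedStep_eq a₀ b₀]
    · intro p s c
      simp [liftSeq, evenPart_moves]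
  law_lift₂ σ' π s φ hφ := by
    rw [SameMeans.law_liftObjective (sameMeans_of_eq e _ true
      (σ := fun l => σ'.1 (constMoves e c₀ l))
      (π := fun l => withUniform e₂ (π.1 l)) ?_ ?_) s hφ,
      law_withUniform_right e₁ e₂ hf]
    · intro p s c
      rw [show p.map Prod.fst ++ [s] = (p ++ [(s, c)]).map Prod.fst by simp]
      exact σ'.2 _ _ (sameObs_moves_constMoves e G.obs₁ c₀ _)
    · intro p s
      simp [liftSeq, evenPart_moves_append]

end Combined

end Game

/-! ### Functions computed in polynomial time -/

/-- `T` is at most polynomial in `μ`. -/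
def PolyBdd {ι : Type} (μ T : ι → ℕ) : Prop := ∃ c : ℕ, ∀ i, T i ≤ (μ i + 2) ^ c

namespace PolyBdd

variable {ι : Type} {μ T U : ι → ℕ}

theorem mono (h : PolyBdd μ T) (hU : ∀ i, U i ≤ T i) : PolyBdd μ U :=
  let ⟨c, hc⟩ := h
  ⟨c, fun i => (hU i).trans (hc i)⟩

theorem const (μ : ι → ℕ) (k : ℕ) : PolyBdd μ fun _ => k :=
  ⟨k, fun i => (Nat.lt_two_pow_self (n := k)).le.trans (Nat.pow_le_pow_left (by omega) k)⟩

theorem self (μ : ι → ℕ) : PolyBdd μ μ := ⟨1, fun i => by rw [pow_one]; omega⟩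

theorem mul (h : PolyBdd μ T) (h' : PolyBdd μ U) : PolyBdd μ fun i => T i * U i :=
  let ⟨c, hc⟩ := h
  let ⟨d, hd⟩ := h'
  ⟨c + d, fun i => by rw [pow_add]; exact Nat.mul_le_mul (hc i) (hd i)⟩

theorem add (h : PolyBdd μ T) (h' : PolyBdd μ U) : PolyBdd μ fun i => T i + U i := by
  obtain ⟨c, hc⟩ := h
  obtain ⟨d, hd⟩ := h'
  refine ⟨c + d + 1, fun i => ?_⟩
  have e₁ : (μ i + 2) ^ c ≤ (μ i + 2) ^ (c + d) := Nat.pow_le_pow_right (by omega) (by omega)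
  have e₂ : (μ i + 2) ^ d ≤ (μ i + 2) ^ (c + d) := Nat.pow_le_pow_right (by omega) (by omega)
  have e₃ : (μ i + 2) ^ (c + d) * 2 ≤ (μ i + 2) ^ (c + d) * (μ i + 2) :=
    Nat.mul_le_mul_left _ (by omega)
  rw [pow_succ]
  change T i + U i ≤ _
  have := hc i
  have := hd i
  omega

theorem pow (μ : ι → ℕ) (c : ℕ) : PolyBdd μ fun i => (μ i + 2) ^ c := ⟨c, fun _ => le_rfl⟩

theorem comp {κ : Type} (h : PolyBdd μ T) (r : κ → ι) :
    PolyBdd (fun k => μ (r k)) fun k => T (r k) :=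
  let ⟨c, hc⟩ := h
  ⟨c, fun k => hc (r k)⟩

end PolyBdd

theorem Runs.size_le {P : Program} {x y : Data} {t : ℕ} (h : Runs P x y t) :
    x.size ≤ t ∧ y.size ≤ t := by
  induction h <;> (try simp only [Data.size] at *) <;> omega

/-- Some program computes `g i` from `f i`, for all `i`, in time polynomial in `μ i`. The index `i`
ranges over the instances of a problem, `f i` is the environment in which the variables of the
instance are found, and `μ i` measures the instance; it need not be the size of `f i`. -/
def Computes {ι : Type} (μ : ι → ℕ) (f g : ι → Data) : Prop :=
  ∃ (P : Program) (c : ℕ), ∀ i, ∃ t ≤ (μ i + 2) ^ c, Runs P (f i) (g i) t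

namespace Data

/-- The output of the program `Program.hd`. -/
def hd : Data → Data
  | nil => nil
  | cons x _ => x

/-- The output of the program `Program.tl`. -/
def tl : Data → Data
  | nil => nil
  | cons _ y => y

theorem size_ofList (l : List Data) : (ofList l).size = 1 + (l.map fun x => x.size + 1).sum := by
  induction l with
  | nil => rfl
  | cons x l ih => simp only [ofList, size, ih, List.map_cons, List.sum_cons]; omega

theorem length_le_size_ofList (l : List Data) : l.length ≤ (ofList l).size := by
  induction l with
  | nil => exact Nat.zero_le _
  | cons x l ih =>
    simp only [List.length_cons, ofList, size]
    omega

theorem size_ofList_le_of_sublist {l l' : List Data} (h : l.Sublist l') :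
    (ofList l).size ≤ (ofList l').size := by
  rw [size_ofList, size_ofList]
  exact Nat.add_le_add_left ((h.map _).sum_le_sum fun _ _ => Nat.zero_le _) 1

theorem ofNatUnary_succ (n : ℕ) : ofNatUnary (n + 1) = cons nil (ofNatUnary n) := rfl

theorem size_ofNatUnary (n : ℕ) : (ofNatUnary n).size = 1 + 2 * n := by
  simp [ofNatUnary, size_ofList, size, mul_comm]

theorem ofNatUnary_eq_ofFun (n : ℕ) : ofNatUnary n = ofFun fun _ : Fin n => nil := by
  simp [ofNatUnary, ofFun]

end Data

namespace Computes

open Data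

variable {ι : Type} {μ : ι → ℕ} {f g h : ι → Data}

theorem congr {g' : ι → Data} (hg : Computes μ f g) (h : ∀ i, g i = g' i) : Computes μ f g' :=
  funext h ▸ hg

/-- It suffices that the running time of one program is bounded polynomially. -/
theorem of_bdd {P : Program} {T : ι → ℕ} (hT : PolyBdd μ T)
    (hP : ∀ i, ∃ t ≤ T i, Runs P (f i) (g i) t) : Computes μ f g := by
  obtain ⟨c, hc⟩ := hT
  exact ⟨P, c, fun i => let ⟨t, ht, hr⟩ := hP i; ⟨t, ht.trans (hc i), hr⟩⟩

/-- The running time bounds the size of the input, so `Computes` controls the size of the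
environment. -/
theorem size_left (hg : Computes μ f g) : PolyBdd μ fun i => (f i).size :=
  let ⟨_, c, hc⟩ := hg
  ⟨c, fun i => let ⟨_, ht, hr⟩ := hc i; hr.size_le.1.trans ht⟩

theorem size_right (hg : Computes μ f g) : PolyBdd μ fun i => (g i).size :=
  let ⟨_, c, hc⟩ := hg
  ⟨c, fun i => let ⟨_, ht, hr⟩ := hc i; hr.size_le.2.trans ht⟩

/-! #### Straight-line programs -/

theorem id (hf : PolyBdd μ fun i => (f i).size) : Computes μ f f :=
  of_bdd ((PolyBdd.const μ 1).add hf) fun _ => ⟨_, le_rfl, Runs.id _⟩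

theorem trans (hg : Computes μ f g) (hh : Computes μ g h) : Computes μ f h := by
  have hf := hg.size_left
  obtain ⟨P, c, hP⟩ := hg
  obtain ⟨Q, d, hQ⟩ := hh
  refine of_bdd (P := P.seq Q)
    (((PolyBdd.pow μ c).add
      (PolyBdd.pow μ d)).add
      ((PolyBdd.const μ 1).add hf)) fun i => ?_
  obtain ⟨t, ht, hr⟩ := hP i
  obtain ⟨u, hu, hr'⟩ := hQ i
  exact ⟨_, by omega, hr.seq hr'⟩

theorem cons (hg : Computes μ f g) (hh : Computes μ f h) :
    Computes μ f fun i => .cons (g i) (h i) := by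
  have hf := hg.size_left
  obtain ⟨P, c, hP⟩ := hg
  obtain ⟨Q, d, hQ⟩ := hh
  refine of_bdd (P := P.cons Q)
    (((PolyBdd.pow μ c).add
      (PolyBdd.pow μ d)).add
      ((PolyBdd.const μ 1).add hf)) fun i => ?_
  obtain ⟨t, ht, hr⟩ := hP i
  obtain ⟨u, hu, hr'⟩ := hQ i
  exact ⟨_, by omega, hr.cons hr'⟩

theorem hd (hg : Computes μ f g) : Computes μ f fun i => (g i).hd := by
  refine hg.trans (of_bdd (P := .hd) ((PolyBdd.const μ 1).add hg.size_right) fun i => ?_)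
  cases g i with
  | nil => exact ⟨_, le_rfl, Runs.hd_nil⟩
  | cons x y => exact ⟨_, le_rfl, Runs.hd_cons x y⟩

theorem tl (hg : Computes μ f g) : Computes μ f fun i => (g i).tl := by
  refine hg.trans (of_bdd (P := .tl) ((PolyBdd.const μ 1).add hg.size_right) fun i => ?_)
  cases g i with
  | nil => exact ⟨_, le_rfl, Runs.tl_nil⟩
  | cons x y => exact ⟨_, le_rfl, Runs.tl_cons x y⟩

theorem const (hf : PolyBdd μ fun i => (f i).size) (x : Data) : Computes μ f fun _ => x := by
  induction x with
  | nil => exact of_bdd ((PolyBdd.const μ 1).add hf) fun _ => ⟨_, le_rfl, Runs.nil _⟩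
  | cons x y hx hy => exact hx.cons hy

theorem comp {κ : Type} (hg : Computes μ f g) (r : κ → ι) :
    Computes (fun k => μ (r k)) (fun k => f (r k)) fun k => g (r k) :=
  let ⟨P, c, hP⟩ := hg
  ⟨P, c, fun k => hP (r k)⟩

theorem ite_of_iff {c : ι → Data} {b : ι → Bool} (hc : Computes μ f c)
    (hb : ∀ i, b i = true ↔ c i ≠ .nil) (hg : Computes μ f g) (hh : Computes μ f h) :
    Computes μ f fun i => if b i then g i else h i := by
  have hf := hg.size_left
  obtain ⟨C, b', hC⟩ := hc
  obtain ⟨P, c', hP⟩ := hg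
  obtain ⟨Q, d, hQ⟩ := hh
  refine of_bdd (P := C.ite P Q)
    ((((PolyBdd.pow μ b').add (PolyBdd.pow μ c')).add (PolyBdd.pow μ d)).add
      ((PolyBdd.const μ 1).add hf)) fun i => ?_
  obtain ⟨s, hs, hr₀⟩ := hC i
  obtain ⟨t, ht, hr⟩ := hP i
  obtain ⟨u, hu, hr'⟩ := hQ i
  have hbi := hb i
  cases h : c i with
  | nil =>
    rw [h] at hr₀ hbi
    rw [if_neg (by simp [hbi])]
    exact ⟨_, by omega, Runs.ite_false hr₀ hr'⟩
  | cons x y =>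
    rw [h] at hr₀ hbi
    rw [if_pos (by simp [hbi])]
    exact ⟨_, by omega, Runs.ite_true hr₀ hr⟩

theorem ite {c : ι → Bool} (hc : Computes μ f fun i => ofBool (c i)) (hg : Computes μ f g)
    (hh : Computes μ f h) : Computes μ f fun i => if c i then g i else h i :=
  ite_of_iff hc (fun i => by cases c i <;> simp [ofBool]) hg hh

/-- The last variable of an extended environment. -/
theorem var {x : ι → Data} (hb : PolyBdd μ fun i => (Data.cons (f i) (x i)).size) :
    Computes μ (fun i => .cons (f i) (x i)) x := (id hb).tl

/-- Weakening by a new variable. -/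
theorem lift {κ : Type} {r : κ → ι} {x : κ → Data} (hg : Computes μ f g)
    (hb : PolyBdd (fun k => μ (r k)) fun k => (Data.cons (f (r k)) (x k)).size) :
    Computes (fun k => μ (r k)) (fun k => .cons (f (r k)) (x k)) fun k => g (r k) :=
  Computes.trans (id hb).hd (hg.comp r)

/-! #### Loops -/

/-- A loop that passes through the states `st i 0, …, st i (n i)`, where the condition `cnd i` fails
for the first time in the last one. -/
theorem iterate {n : ι → ℕ} {st cnd : ι → ℕ → Data} (hn : PolyBdd μ n)
    (hc : Computes (fun p : Σ i, Fin (n i + 1) => μ p.1) (fun p => st p.1 p.2)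
      fun p => cnd p.1 p.2)
    (hpos : ∀ i k, k < n i → ∃ d e, cnd i k = .cons d e) (hend : ∀ i, cnd i (n i) = .nil)
    (hb : Computes (fun p : Σ i, Fin (n i) => μ p.1) (fun p => st p.1 p.2)
      fun p => st p.1 (p.2 + 1)) :
    Computes μ (fun i => st i 0) fun i => st i (n i) := by
  obtain ⟨C, c, hC⟩ := hc
  obtain ⟨B, b, hB⟩ := hb
  have hM : PolyBdd μ fun i => 2 * (μ i + 2) ^ c + (μ i + 2) ^ b + 1 :=
    (((PolyBdd.const μ 2).mul (PolyBdd.pow μ c)).add (PolyBdd.pow μ b)).add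
      (PolyBdd.const μ 1)
  refine of_bdd (P := C.loop B) ((hn.add (PolyBdd.const μ 1)).mul hM) fun i => ?_
  set M := 2 * (μ i + 2) ^ c + (μ i + 2) ^ b + 1 with hMdef
  have key : ∀ j ≤ n i, ∃ t ≤ (j + 1) * M,
      Runs (C.loop B) (st i (n i - j)) (st i (n i)) t := by
    intro j
    induction j with
    | zero =>
      intro _
      obtain ⟨t, ht, hr⟩ := hC ⟨i, ⟨n i, Nat.lt_succ_self _⟩⟩
      simp only [hend] at hr ht
      have := hr.size_le.1
      rw [Nat.sub_zero]
      exact ⟨_, by omega, Runs.loop_stop hr⟩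
    | succ j ih =>
      intro hj
      obtain ⟨u, hu, hr'⟩ := ih (by omega)
      obtain ⟨t, ht, hr⟩ := hC ⟨i, ⟨n i - (j + 1), by omega⟩⟩
      obtain ⟨v, hv, hr''⟩ := hB ⟨i, ⟨n i - (j + 1), by omega⟩⟩
      obtain ⟨d, e, hde⟩ := hpos i (n i - (j + 1)) (by omega)
      simp only [hde, show n i - (j + 1) + 1 = n i - j by omega] at hr hr'' ht hv
      have := hr.size_le.1
      refine ⟨_, ?_, Runs.loop_step hr hr'' hr'⟩
      rw [add_mul (j + 1)]
      omega
  obtain ⟨t, ht, hr⟩ := key (n i) le_rfl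
  rw [Nat.sub_self] at hr
  exact ⟨t, ht, hr⟩

theorem elem_bdd {n : ι → ℕ} {x : ∀ i, Fin (n i) → Data} (hx : Computes μ f fun i => ofFun (x i)) :
    PolyBdd (fun p : Σ i, Fin (n i) => μ p.1)
      fun p => (Data.cons (f p.1) (x p.1 p.2)).size := by
  refine (((PolyBdd.const μ 1).add (hx.size_left.add hx.size_right)).comp
    (fun p : Σ i, Fin (n i) => p.1)).mono fun p => ?_
  have : (x p.1 p.2).size + 1 ≤ ((List.ofFn (x p.1)).map fun x => x.size + 1).sum :=
    List.single_le_sum (fun _ _ => Nat.zero_le _) _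
      (List.mem_map_of_mem (List.mem_ofFn.2 ⟨_, rfl⟩))
  simp only [size, ofFun, size_ofList]
  omega

theorem length_bdd {L : ι → List Data} (hL : Computes μ f fun i => ofList (L i)) :
    PolyBdd μ fun i => (L i).length :=
  hL.size_right.mono fun _ => length_le_size_ofList _

theorem size_bdd_of_fun {n : ι → ℕ} {x : ∀ i, Fin (n i) → Data}
    (hx : Computes μ f fun i => ofFun (x i)) : PolyBdd μ n := by
  simpa using hx.length_bdd

/-- Folding over a list: `acc i k` is the value after `k` elements. The loop keeps the environment,
the value, and the rest of the list. -/
theorem foldList {L : ι → List Data} {acc : ι → ℕ → Data}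
    (hL : Computes μ f fun i => ofList (L i)) (h₀ : Computes μ f fun i => acc i 0)
    (hs : Computes (fun p : Σ i, Fin (L i).length => μ p.1)
      (fun p => .cons (f p.1) (.cons (acc p.1 p.2) ((L p.1)[p.2]))) fun p => acc p.1 (p.2 + 1)) :
    Computes μ f fun i => acc i (L i).length := by
  have hacc : PolyBdd (fun p : Σ i, Fin ((L i).length + 1) => μ p.1)
      fun p => (acc p.1 p.2).size := by
    obtain ⟨c, hc⟩ := hs.size_right
    obtain ⟨c₀, hc₀⟩ := h₀.size_right
    refine (((PolyBdd.pow μ c).add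
      (PolyBdd.pow μ c₀)).comp
      (fun p : Σ i, Fin ((L i).length + 1) => p.1)).mono ?_
    rintro ⟨i, ⟨k, hk⟩⟩
    rcases k with _ | k
    · exact (hc₀ i).trans (by simp)
    · exact (hc ⟨i, ⟨k, by omega⟩⟩).trans (by simp)
  let st : ι → ℕ → Data := fun i k => .cons (f i) (.cons (acc i k) (ofList ((L i).drop k)))
  have hst : PolyBdd (fun p : Σ i, Fin ((L i).length + 1) => μ p.1)
      fun p => (st p.1 p.2).size := by
    refine (((PolyBdd.const μ 2).add (h₀.size_left.add hL.size_right)).comp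
      (fun p : Σ i, Fin ((L i).length + 1) => p.1)).add hacc |>.mono fun p => ?_
    have := size_ofList_le_of_sublist (List.drop_sublist p.2 (L p.1))
    simp only [st, size]
    omega
  have hid := id hst
  have hid' := hid.comp (fun p : Σ i, Fin (L i).length =>
    (⟨p.1, p.2.castSucc⟩ : Σ i, Fin ((L i).length + 1)))
  have hdrop (p : Σ i, Fin (L i).length) : (L p.1).drop (p.2 : ℕ) =
      (L p.1)[p.2] :: (L p.1).drop (p.2 + 1) := by
    rw [List.drop_eq_getElem_cons p.2.2]; rfl
  have hloop : Computes μ (fun i => st i 0) fun i => st i (L i).length := by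
    refine iterate (cnd := fun i k => (st i k).tl.tl) hL.length_bdd hid.tl.tl ?_ ?_ ?_
    · intro i k hk
      simp only [st, Data.tl]
      rw [List.drop_eq_getElem_cons hk]
      exact ⟨_, _, rfl⟩
    · intro i
      simp [st, Data.tl, ofList]
    · have hA : Computes (fun p : Σ i, Fin (L i).length => μ p.1) (fun p => st p.1 p.2)
          (fun p => .cons (f p.1) (.cons (acc p.1 p.2) ((L p.1)[p.2]))) := by
        have := hid'.hd.cons (hid'.tl.hd.cons hid'.tl.tl.hd)
        simpa only [st, Data.tl, Data.hd, Fin.val_castSucc, hdrop, ofList] using this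
      have hB := hid'.hd.cons ((hA.trans hs).cons hid'.tl.tl.tl)
      simpa only [st, Data.tl, Data.hd, Fin.val_castSucc, hdrop, ofList] using hB
  have hstart : Computes μ f fun i => st i 0 :=
    (id h₀.size_left).cons (h₀.cons hL)
  have := (hstart.trans hloop).tl.hd
  simpa only [st, Data.tl, Data.hd] using this

/-- Folding over a table. -/
theorem fold {n : ι → ℕ} {x : ∀ i, Fin (n i) → Data} {acc : ι → ℕ → Data}
    (hx : Computes μ f fun i => ofFun (x i)) (h₀ : Computes μ f fun i => acc i 0)
    (hs : Computes (fun p : Σ i, Fin (n i) => μ p.1)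
      (fun p => .cons (f p.1) (.cons (acc p.1 p.2) (x p.1 p.2))) fun p => acc p.1 (p.2 + 1)) :
    Computes μ f fun i => acc i (n i) := by
  have := foldList (L := fun i => List.ofFn (x i)) hx h₀ (by
    have := hs.comp (fun p : Σ i, Fin (List.ofFn (x i)).length =>
      (⟨p.1, Fin.cast (by simp) p.2⟩ : Σ i, Fin (n i)))
    simpa [Fin.cast] using this)
  simpa using this

end Computes

namespace Data

theorem size_ofList_append (l l' : List Data) :
    (ofList (l ++ l')).size + 1 = (ofList l).size + (ofList l').size := by
  simp only [size_ofList, List.map_append, List.sum_append]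
  omega

theorem size_ofList_reverse (l : List Data) : (ofList l.reverse).size = (ofList l).size := by
  simp only [size_ofList, List.map_reverse, List.sum_reverse]

theorem size_ofList_flatten_le (L : List (List Data)) :
    (ofList L.flatten).size ≤ (ofList (L.map ofList)).size := by
  induction L with
  | nil => exact le_rfl
  | cons l L ih =>
    have := size_ofList_append l L.flatten
    simp only [List.flatten_cons, List.map_cons, ofList, size]
    omega

theorem size_ofList_le {l : List Data} {B : ℕ} (h : ∀ x ∈ l, x.size ≤ B) :
    (ofList l).size ≤ 1 + l.length * (B + 1) := by
  rw [size_ofList]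
  refine Nat.add_le_add_left ?_ 1
  have := List.sum_le_card_nsmul (l.map fun x => x.size + 1) (B + 1) (by simpa using h)
  rwa [List.length_map, smul_eq_mul] at this

end Data

namespace Computes

open Data

variable {ι : Type} {μ : ι → ℕ} {f : ι → Data}

/-! #### Lists and tables -/

theorem reverse {L : ι → List Data} (hL : Computes μ f fun i => ofList (L i)) :
    Computes μ f fun i => ofList (L i).reverse := by
  have hb : PolyBdd (fun p : Σ i, Fin (L i).length => μ p.1) fun p =>
      (Data.cons (f p.1) (.cons (ofList ((L p.1).take p.2).reverse) ((L p.1)[p.2]))).size := by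
    refine (((PolyBdd.const μ 2).add (hL.size_left.add (hL.size_right.add hL.size_right))).comp
      (fun p : Σ i, Fin (L i).length => p.1)).mono fun p => ?_
    have h₁ := size_ofList_le_of_sublist (List.take_sublist (p.2 : ℕ) (L p.1))
    have h₂ := size_ofList_le_of_sublist
      (List.singleton_sublist.2 (List.getElem_mem p.2.2))
    simp only [ofList, size] at h₂
    simp only [size, size_ofList_reverse, Fin.getElem_fin]
    omega
  have := foldList (acc := fun i k => ofList ((L i).take k).reverse) hL
    (by simpa [ofList] using const hL.size_left .nil) (by
      refine congr ((id hb).tl.tl.cons (id hb).tl.hd) fun p => ?_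
      rw [← List.take_concat_get' _ _ p.2.2, List.reverse_append]
      rfl)
  simpa using this

/-- The elements of the first list are put in front of the second one, the last one first. -/
theorem append {L L' : ι → List Data} (hL : Computes μ f fun i => ofList (L i))
    (hL' : Computes μ f fun i => ofList (L' i)) :
    Computes μ f fun i => ofList (L i ++ L' i) := by
  have hb : PolyBdd (fun p : Σ i, Fin (L i).reverse.length => μ p.1) fun p => (Data.cons (f p.1)
      (.cons (ofList (((L p.1).reverse.take p.2).reverse ++ L' p.1))
        ((L p.1).reverse[p.2]))).size := by
    refine (((PolyBdd.const μ 2).add (hL.size_left.add ((hL.size_right.add hL'.size_right).add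
      hL.size_right))).comp (fun p : Σ i, Fin (L i).reverse.length => p.1)).mono fun p => ?_
    have h₁ := size_ofList_le_of_sublist (List.take_sublist (p.2 : ℕ) (L p.1).reverse)
    have h₂ := size_ofList_le_of_sublist
      (List.singleton_sublist.2 (List.getElem_mem p.2.2))
    have h₃ := size_ofList_append ((L p.1).reverse.take p.2).reverse (L' p.1)
    simp only [ofList, size] at h₂
    rw [size_ofList_reverse] at *
    simp only [size, Fin.getElem_fin]
    omega
  have := foldList (acc := fun i k => ofList (((L i).reverse.take k).reverse ++ L' i)) hL.reverse
    (by simpa using hL') (by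
      refine congr ((id hb).tl.tl.cons (id hb).tl.hd) fun p => ?_
      rw [← List.take_concat_get' _ _ p.2.2, List.reverse_append]
      rfl)
  simpa [List.take_of_length_le] using this

theorem flatten {L : ι → List (List Data)} (hL : Computes μ f fun i => ofList ((L i).map ofList)) :
    Computes μ f fun i => ofList (L i).flatten := by
  have hb : PolyBdd (fun p : Σ i, Fin ((L i).map ofList).length => μ p.1) fun p =>
      (Data.cons (f p.1) (.cons (ofList ((L p.1).take p.2).flatten)
        (((L p.1).map ofList)[p.2]))).size := by
    refine (((PolyBdd.const μ 2).add (hL.size_left.add (hL.size_right.add hL.size_right))).comp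
      (fun p : Σ i, Fin ((L i).map ofList).length => p.1)).mono fun p => ?_
    have h₁ := size_ofList_le_of_sublist ((List.take_sublist (p.2 : ℕ) (L p.1)).map ofList)
    have h₂ := size_ofList_le_of_sublist
      (List.singleton_sublist.2 (List.getElem_mem p.2.2))
    have h₃ := size_ofList_flatten_le ((L p.1).take p.2)
    simp only [ofList, size] at h₂
    simp only [size, Fin.getElem_fin]
    omega
  have := foldList (acc := fun i k => ofList ((L i).take k).flatten) hL
    (by simpa [ofList] using const hL.size_left .nil) (by
      have hx : Computes (fun p : Σ i, Fin ((L i).map ofList).length => μ p.1)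
          (fun p => Data.cons (f p.1) (.cons (ofList ((L p.1).take p.2).flatten)
            (((L p.1).map ofList)[p.2])))
          (fun p => ofList ((L p.1)[(p.2 : ℕ)]'(by simpa using p.2.2))) := by
        simpa [Data.tl] using (id hb).tl.tl
      refine congr ((id hb).tl.hd.append hx) fun p => ?_
      rw [← List.take_concat_get' _ _ (by simpa using p.2.2), List.flatten_append]
      simp)
  simpa using this

/-- Building a table from a table, entry by entry. The entry is computed in the environment extended
by the given entry. -/
theorem map {n : ι → ℕ} {x g : ∀ i, Fin (n i) → Data} (hx : Computes μ f fun i => ofFun (x i))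
    (hg : Computes (fun p : Σ i, Fin (n i) => μ p.1) (fun p => .cons (f p.1) (x p.1 p.2))
      fun p => g p.1 p.2) :
    Computes μ f fun i => ofFun (g i) := by
  have hb : PolyBdd (fun p : Σ i, Fin (n i) => μ p.1) fun p => (Data.cons (f p.1)
      (.cons (ofList ((List.ofFn (g p.1)).take p.2).reverse) (x p.1 p.2))).size := by
    obtain ⟨c, hc⟩ := hg.size_right
    refine ((PolyBdd.const _ 1).add (hx.elem_bdd.add
      (((PolyBdd.const μ 1).add (hx.size_bdd_of_fun.mul
        ((PolyBdd.pow μ c).add (PolyBdd.const μ 1)))).comp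
        (fun p : Σ i, Fin (n i) => p.1)))).mono fun p => ?_
    have h₁ := size_ofList_le_of_sublist (List.take_sublist (p.2 : ℕ) (List.ofFn (g p.1)))
    have h₂ := size_ofList_le (l := List.ofFn (g p.1)) (B := (μ p.1 + 2) ^ c) (by
      intro y hy
      obtain ⟨k, rfl⟩ := List.mem_ofFn.1 hy
      exact hc ⟨p.1, k⟩)
    rw [List.length_ofFn] at h₂
    simp only [size, size_ofList_reverse]
    omega
  have := fold (acc := fun i k => ofList ((List.ofFn (g i)).take k).reverse) hx
    (by simpa [ofList] using const hx.size_left .nil) (by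
      have hg' := ((id hb).hd.cons (id hb).tl.tl).trans hg
      refine congr (hg'.cons (id hb).tl.hd) fun p => ?_
      rw [← List.take_concat_get' _ _ (by simp), List.reverse_append]
      simp [Data.hd, Data.tl, ofList])
  have := reverse this
  simpa [ofFun, List.take_of_length_le] using this

/-! #### Unary numbers -/

theorem zero (hf : PolyBdd μ fun i => (f i).size) : Computes μ f fun _ => ofNatUnary 0 :=
  const hf _

theorem replicate {n : ι → ℕ} {x : ι → Data} (hn : Computes μ f fun i => ofNatUnary (n i))
    (hx : Computes μ f x) : Computes μ f fun i => ofList (List.replicate (n i) (x i)) := by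
  replace hn := hn.congr fun i => ofNatUnary_eq_ofFun (n i)
  have := hn.map (g := fun i _ => x i) (hx.lift hn.elem_bdd)
  exact this.congr fun i => by rw [ofFun, List.ofFn_const]

theorem add {m n : ι → ℕ} (hm : Computes μ f fun i => ofNatUnary (m i))
    (hn : Computes μ f fun i => ofNatUnary (n i)) :
    Computes μ f fun i => ofNatUnary (m i + n i) := by
  exact (append hm hn).congr fun i => by rw [List.replicate_append_replicate]; rfl

theorem mul {m n : ι → ℕ} (hm : Computes μ f fun i => ofNatUnary (m i))
    (hn : Computes μ f fun i => ofNatUnary (n i)) :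
    Computes μ f fun i => ofNatUnary (m i * n i) := by
  have := flatten (L := fun i => List.replicate (m i) (List.replicate (n i) Data.nil))
    ((hm.replicate hn).congr fun i => by rw [List.map_replicate]; rfl)
  exact this.congr fun i => by rw [List.flatten_replicate_replicate]; rfl

theorem drop {n : ι → ℕ} {L : ι → List Data} (hn : Computes μ f fun i => ofNatUnary (n i))
    (hL : Computes μ f fun i => ofList (L i)) :
    Computes μ f fun i => ofList ((L i).drop (n i)) := by
  replace hn := hn.congr fun i => ofNatUnary_eq_ofFun (n i)
  have hb : PolyBdd (fun p : Σ i, Fin (n i) => μ p.1) fun p =>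
      (Data.cons (f p.1) (.cons (ofList ((L p.1).drop p.2)) .nil)).size := by
    refine (((PolyBdd.const μ 3).add (hL.size_left.add hL.size_right)).comp
      (fun p : Σ i, Fin (n i) => p.1)).mono fun p => ?_
    have h₁ := size_ofList_le_of_sublist (List.drop_sublist (p.2 : ℕ) (L p.1))
    simp only [size]
    omega
  refine fold (acc := fun i k => ofList ((L i).drop k)) hn (by simpa using hL) ?_
  refine congr (id hb).tl.hd.tl fun p => ?_
  rw [← List.tail_drop]
  cases (L p.1).drop p.2 <;> rfl

theorem sub {m n : ι → ℕ} (hm : Computes μ f fun i => ofNatUnary (m i))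
    (hn : Computes μ f fun i => ofNatUnary (n i)) :
    Computes μ f fun i => ofNatUnary (m i - n i) := by
  simpa [ofNatUnary] using drop hn hm

theorem succ {m : ι → ℕ} (hm : Computes μ f fun i => ofNatUnary (m i)) :
    Computes μ f fun i => ofNatUnary (m i + 1) :=
  (const hm.size_left .nil).cons hm

/-- The entry of a table at a computed position. -/
theorem get {n : ι → ℕ} {x : ∀ i, Fin (n i) → Data} (k : ∀ i, Fin (n i))
    (hx : Computes μ f fun i => ofFun (x i)) (hk : Computes μ f fun i => ofNatUnary (k i)) :
    Computes μ f fun i => x i (k i) := by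
  refine congr (drop hk hx).hd fun i => ?_
  rw [List.drop_eq_getElem_cons (by simp)]
  simp [ofList, Data.hd]

theorem getElem {n : ι → ℕ} {L : ι → List Data} (hn : ∀ i, n i < (L i).length)
    (hL : Computes μ f fun i => ofList (L i)) (hk : Computes μ f fun i => ofNatUnary (n i)) :
    Computes μ f fun i => (L i)[n i]'(hn i) := by
  refine congr (drop hk hL).hd fun i => ?_
  rw [List.drop_eq_getElem_cons (hn i)]
  rfl

/-- The table of the numbers below `n`. -/
theorem range {n : ι → ℕ} (hn : Computes μ f fun i => ofNatUnary (n i)) :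
    Computes μ f fun i => ofFun fun k : Fin (n i) => ofNatUnary k := by
  have hn' := hn
  replace hn := hn.congr fun i => ofNatUnary_eq_ofFun (n i)
  have hnb := hn.size_bdd_of_fun
  have hb : PolyBdd (fun p : Σ i, Fin (n i) => μ p.1) fun p => (Data.cons (f p.1)
      (.cons (.cons (ofNatUnary p.2) (ofList ((List.range p.2).map ofNatUnary).reverse))
        .nil)).size := by
    refine (((PolyBdd.const μ 6).add (hn.size_left.add (((PolyBdd.const μ 2).mul hnb).add
      (hnb.mul (((PolyBdd.const μ 2).mul hnb).add (PolyBdd.const μ 2)))))).comp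
      (fun p : Σ i, Fin (n i) => p.1)).mono fun p => ?_
    have h₁ := size_ofList_le (l := (List.range p.2).map ofNatUnary) (B := 1 + 2 * n p.1) (by
      simp only [List.mem_map, List.mem_range, forall_exists_index, and_imp]
      rintro _ k hk rfl
      rw [size_ofNatUnary]
      omega)
    rw [List.length_map, List.length_range] at h₁
    have h₂ : (p.2 : ℕ) * (1 + 2 * n p.1 + 1) ≤ n p.1 * (2 * n p.1 + 2) :=
      Nat.mul_le_mul p.2.2.le (by omega)
    simp only [size, size_ofList_reverse, size_ofNatUnary]
    omega
  have := fold (acc := fun i k =>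
    Data.cons (ofNatUnary k) (ofList ((List.range k).map ofNatUnary).reverse)) hn
    (const hn.size_left _) (by
      refine congr ((((const hb .nil).cons (id hb).tl.hd.hd).cons
        ((id hb).tl.hd.hd.cons (id hb).tl.hd.tl))) fun p => ?_
      rw [List.range_succ, List.map_append, List.reverse_append]
      simp only [Data.hd, Data.tl, ofNatUnary_succ, List.map_cons, List.map_nil,
        List.reverse_singleton, List.singleton_append, ofList])
  have := reverse this.tl
  refine congr this fun i => ?_
  simp only [List.reverse_reverse, ofFun, List.ofFn_eq_map, List.map_map,
    ← List.map_coe_finRange_eq_range]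
  rfl

theorem ofBool_ite {c : ι → Bool} {b b' : ι → Bool} (hc : Computes μ f fun i => ofBool (c i))
    (hb : Computes μ f fun i => ofBool (b i)) (hb' : Computes μ f fun i => ofBool (b' i)) :
    Computes μ f fun i => ofBool (if c i then b i else b' i) := by
  refine congr (ite hc hb hb') fun i => ?_
  cases c i <;> rfl

theorem and {b b' : ι → Bool} (hb : Computes μ f fun i => ofBool (b i))
    (hb' : Computes μ f fun i => ofBool (b' i)) :
    Computes μ f fun i => ofBool (b i && b' i) := by
  refine congr (ofBool_ite hb hb' hb) fun i => ?_
  cases b i <;> rfl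

theorem not {b : ι → Bool} (hb : Computes μ f fun i => ofBool (b i)) :
    Computes μ f fun i => ofBool (!b i) := by
  refine congr (ofBool_ite (b := fun _ => false) (b' := fun _ => true) hb
    (const hb.size_left _) (const hb.size_left _)) fun i => ?_
  cases b i <;> rfl

theorem le {m n : ι → ℕ} (hm : Computes μ f fun i => ofNatUnary (m i))
    (hn : Computes μ f fun i => ofNatUnary (n i)) :
    Computes μ f fun i => ofBool (decide (m i ≤ n i)) := by
  have h : Computes μ f fun i => ofBool (decide (n i < m i)) := by
    refine congr (ite_of_iff (b := fun i => decide (n i < m i)) (hm.sub hn) (fun i => ?_)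
      (const hm.size_left (ofBool true)) (const hm.size_left (ofBool false))) fun i => ?_
    · rcases h : m i - n i with _ | k
      · simp [ofNatUnary, ofList]
        omega
      · simp [ofNatUnary_succ]
        omega
    · by_cases h : n i < m i <;> simp [h]
  exact h.not.congr fun i => by simp [← decide_not]

theorem eq {m n : ι → ℕ} (hm : Computes μ f fun i => ofNatUnary (m i))
    (hn : Computes μ f fun i => ofNatUnary (n i)) :
    Computes μ f fun i => ofBool (decide (m i = n i)) := by
  refine congr ((hm.le hn).and (hn.le hm)) fun i => ?_
  rw [← Bool.decide_and]
  congr 1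
  rw [decide_eq_decide]
  omega

/-- The conjunction of a family of Boolean values. -/
theorem all {n : ι → ℕ} {x : ∀ i, Fin (n i) → Data} {b : ∀ i, Fin (n i) → Bool}
    (hx : Computes μ f fun i => ofFun (x i))
    (hb : Computes (fun p : Σ i, Fin (n i) => μ p.1) (fun p => .cons (f p.1) (x p.1 p.2))
      fun p => ofBool (b p.1 p.2)) :
    Computes μ f fun i => ofBool (decide (∀ k, b i k = true)) := by
  have he := (hx.elem_bdd.add (PolyBdd.const _ 4))
  have hE : PolyBdd (fun p : Σ i, Fin (n i) => μ p.1) fun p => (Data.cons (f p.1)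
      (.cons (ofBool (decide (∀ k : Fin (n p.1), k < p.2 → b p.1 k = true)))
        (x p.1 p.2))).size := by
    refine he.mono fun p => ?_
    have : ∀ c : Bool, (ofBool c).size ≤ 3 := fun c => by cases c <;> decide
    have := this (decide (∀ k : Fin (n p.1), k < p.2 → b p.1 k = true))
    simp only [size]
    omega
  have := fold (acc := fun i k => ofBool (decide (∀ j : Fin (n i), (j : ℕ) < k → b i j = true))) hx
    (by simpa using const hx.size_left (ofBool true)) (by
      have h₁ := ((id hE).hd.cons (id hE).tl.tl).trans hb
      refine congr ((id hE).tl.hd.and h₁) fun p => ?_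
      rw [← Bool.decide_coe (b p.1 p.2), ← Bool.decide_and]
      congr 1
      rw [decide_eq_decide]
      constructor
      · rintro ⟨h, h'⟩ j hj
        rcases Nat.lt_succ_iff_lt_or_eq.1 hj with hj | hj
        · exact h j hj
        · rwa [Fin.ext hj]
      · exact fun h => ⟨fun j hj => h j (Nat.lt_succ_of_lt hj), h _ (Nat.lt_succ_self _)⟩)
  simpa using this

/-! #### Arithmetic with exponential bounds -/

theorem size_ofNatUnary_bdd {n : ι → ℕ} (hn : PolyBdd μ n) :
    PolyBdd μ fun i => (ofNatUnary (n i)).size :=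
  ((PolyBdd.const μ 1).add ((PolyBdd.const μ 2).mul hn)).mono fun i => by
    rw [size_ofNatUnary]

/-- From binary to unary. The loop over the bits keeps a power of two and the number given by the
bits read so far. -/
theorem unary_of_binary {n : ι → ℕ} (hn : PolyBdd μ n) (h : Computes μ f fun i => ofNat (n i)) :
    Computes μ f fun i => ofNatUnary (n i) := by
  have hpow : ∀ (m k : ℕ), k < m.bits.length → 2 ^ k ≤ m := fun m k hk => by
    rw [Nat.size_eq_bits_len, Nat.lt_size] at hk
    exact hk
  have hE : PolyBdd (fun p : Σ i, Fin ((n i).bits.map ofBool).length => μ p.1) fun p =>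
      (Data.cons (f p.1) (.cons (.cons (ofNatUnary (2 ^ (p.2 : ℕ)))
        (ofNatUnary (n p.1 % 2 ^ (p.2 : ℕ)))) (((n p.1).bits.map ofBool)[p.2]))).size := by
    refine (((PolyBdd.const μ 3).add (h.size_left.add (h.size_right.add
      ((size_ofNatUnary_bdd hn).add (size_ofNatUnary_bdd hn))))).comp
      (fun p : Σ i, Fin ((n i).bits.map ofBool).length => p.1)).mono fun p => ?_
    have h₁ := hpow (n p.1) p.2 (by simpa using p.2.2)
    have h₂ := Nat.mod_le (n p.1) (2 ^ (p.2 : ℕ))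
    have h₃ := size_ofList_le_of_sublist
      (List.singleton_sublist.2 (List.getElem_mem p.2.2))
    simp only [ofList, size] at h₃
    simp only [size, size_ofNatUnary, ofNat, Fin.getElem_fin]
    omega
  have := foldList (acc := fun i k => Data.cons (ofNatUnary (2 ^ k)) (ofNatUnary (n i % 2 ^ k))) h
    ((const h.size_left (.cons (ofNatUnary 1) (ofNatUnary 0))).congr fun i => by
      rw [pow_zero, Nat.mod_one]) (by
      have hP : Computes _ _ (fun p : Σ i, Fin ((n i).bits.map ofBool).length =>
        ofNatUnary (2 ^ (p.2 : ℕ))) := (id hE).tl.hd.hd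
      have hV : Computes _ _ (fun p : Σ i, Fin ((n i).bits.map ofBool).length =>
        ofNatUnary (n p.1 % 2 ^ (p.2 : ℕ))) := (id hE).tl.hd.tl
      have hbit : Computes (fun p : Σ i, Fin ((n i).bits.map ofBool).length => μ p.1)
          (fun p : Σ i, Fin ((n i).bits.map ofBool).length =>
          Data.cons (f p.1) (.cons (.cons (ofNatUnary (2 ^ (p.2 : ℕ)))
            (ofNatUnary (n p.1 % 2 ^ (p.2 : ℕ)))) (((n p.1).bits.map ofBool)[p.2])))
          (fun p => ofBool ((n p.1).testBit p.2)) := by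
        refine congr (id hE).tl.tl fun p => ?_
        have hp : (p.2 : ℕ) < (n p.1).bits.length := by simpa using p.2.2
        rw [Nat.testBit_eq_inth, List.getI_eq_getElem _ hp]
        simp [Data.tl]
      refine congr ((hP.add hP).cons (ite hbit (hV.add hP) hV)) fun p => ?_
      have h2 : 2 ^ (p.2 : ℕ) + 2 ^ (p.2 : ℕ) = 2 ^ ((p.2 : ℕ) + 1) := by ring
      rw [h2, Nat.mod_pow_succ]
      congr 1
      have := Nat.mod_two_eq_zero_or_one (n p.1 / 2 ^ (p.2 : ℕ))
      rw [Nat.testBit_eq_decide_div_mod_eq]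
      rcases this with h | h <;> simp [h])
  refine congr this.tl fun i => ?_
  simp only [Data.tl, List.length_map]
  rw [Nat.mod_eq_of_lt]
  rw [Nat.size_eq_bits_len]
  exact Nat.lt_size_self _

/-- Exact division of unary numbers, by repeated subtraction; `m` rounds are enough to divide
`m`. -/
theorem div {m d : ι → ℕ} (hd : ∀ i, d i ∣ m i) (hd' : ∀ i, 0 < d i)
    (hm : Computes μ f fun i => ofNatUnary (m i)) (hn : Computes μ f fun i => ofNatUnary (d i)) :
    Computes μ f fun i => ofNatUnary (m i / d i) := by
  have hm' := hm
  simp only [ofNatUnary_eq_ofFun] at hm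
  have hE : PolyBdd (fun p : Σ i, Fin (m i) => μ p.1) fun p => (Data.cons (f p.1)
      (.cons (.cons (ofNatUnary (m p.1 - p.2 * d p.1)) (ofNatUnary (min p.2 (m p.1 / d p.1))))
        .nil)).size := by
    refine (((PolyBdd.const μ 4).add (hm.size_left.add (hm'.size_right.add
      hm'.size_right))).comp (fun p : Σ i, Fin (m i) => p.1)).mono fun p => ?_
    have := p.2.2
    simp only [size, size_ofNatUnary]
    omega
  have := fold (acc := fun i k =>
      Data.cons (ofNatUnary (m i - k * d i)) (ofNatUnary (min k (m i / d i)))) hm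
    (by simpa using hm'.cons (zero hm'.size_left)) (by
      have hR : Computes _ _ (fun p : Σ i, Fin (m i) => ofNatUnary (m p.1 - p.2 * d p.1)) :=
        (id hE).tl.hd.hd
      have hQ : Computes _ _ (fun p : Σ i, Fin (m i) => ofNatUnary (min p.2 (m p.1 / d p.1))) :=
        (id hE).tl.hd.tl
      have hD : Computes _ _ (fun p : Σ i, Fin (m i) => ofNatUnary (d p.1)) := hn.lift hE
      refine congr ((hR.sub hD).cons
        (ite ((succ (zero hR.size_left)).le hR) hQ.succ hQ)) fun p => ?_
      obtain ⟨q, hq⟩ := hd p.1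
      have hpos := hd' p.1
      have hq' : m p.1 / d p.1 = q := by rw [hq, Nat.mul_div_cancel_left _ hpos]
      have e₁ : m p.1 - p.2 * d p.1 - d p.1 = m p.1 - (p.2 + 1) * d p.1 := by
        rw [add_mul, one_mul, Nat.sub_sub]
      have e₂ : 0 + 1 ≤ m p.1 - p.2 * d p.1 ↔ (p.2 : ℕ) < q := by
        generalize (p.2 : ℕ) = k
        rw [hq, mul_comm k, ← Nat.mul_sub, zero_add, Nat.one_le_iff_ne_zero, mul_ne_zero_iff]
        omega
      rw [e₁, hq']
      by_cases h : (p.2 : ℕ) < q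
      · rw [if_pos (by simpa using e₂.2 h)]
        congr 2
        omega
      · rw [if_neg (by simpa using fun h' => h (e₂.1 h'))]
        congr 2
        omega)
  refine congr this.tl fun i => ?_
  simp only [Data.tl]
  rw [min_eq_right (Nat.div_le_self _ _)]

/-- The product of a family of positive numbers. -/
theorem prod {n : ι → ℕ} {x : ∀ i, Fin (n i) → Data} {m : ∀ i, Fin (n i) → ℕ}
    (hpos : ∀ i k, 0 < m i k) (hB : PolyBdd μ fun i => ∏ k, m i k)
    (hx : Computes μ f fun i => ofFun (x i))
    (hm : Computes (fun p : Σ i, Fin (n i) => μ p.1) (fun p => .cons (f p.1) (x p.1 p.2))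
      fun p => ofNatUnary (m p.1 p.2)) :
    Computes μ f fun i => ofNatUnary (∏ k, m i k) := by
  have hE : PolyBdd (fun p : Σ i, Fin (n i) => μ p.1) fun p => (Data.cons (f p.1)
      (.cons (ofNatUnary (∏ k ∈ Finset.univ.filter (fun k : Fin (n p.1) => (k : ℕ) < p.2), m p.1 k))
        (x p.1 p.2))).size := by
    refine ((PolyBdd.const _ 1).add (hx.elem_bdd.add ((size_ofNatUnary_bdd hB).comp
      (fun p : Σ i, Fin (n i) => p.1)))).mono fun p => ?_
    have : ∏ k ∈ Finset.univ.filter (fun k : Fin (n p.1) => (k : ℕ) < p.2), m p.1 k ≤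
        ∏ k, m p.1 k :=
      Finset.prod_le_prod_of_subset_of_one_le' (Finset.filter_subset _ _)
        fun k _ _ => hpos _ _
    simp only [size, size_ofNatUnary]
    omega
  have := fold (acc := fun i k => ofNatUnary
      (∏ j ∈ Finset.univ.filter (fun j : Fin (n i) => (j : ℕ) < k), m i j)) hx
    (by simpa using const hx.size_left (ofNatUnary 1)) (by
      have h₁ := ((id hE).hd.cons (id hE).tl.tl).trans hm
      have h₂ : Computes _ _ (fun p : Σ i, Fin (n i) =>
        ofNatUnary (∏ k ∈ Finset.univ.filter (fun k : Fin (n p.1) => (k : ℕ) < p.2), m p.1 k)) :=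
        (id hE).tl.hd
      refine congr (h₂.mul h₁) fun p => ?_
      have : (Finset.univ.filter fun j : Fin (n p.1) => (j : ℕ) < p.2 + 1) =
          insert p.2 (Finset.univ.filter fun j : Fin (n p.1) => (j : ℕ) < p.2) := by
        ext j
        simp only [Finset.mem_filter, Finset.mem_univ, true_and, Finset.mem_insert, Fin.ext_iff]
        omega
      rw [this, Finset.prod_insert (by simp), mul_comm])
  simpa using this

end Computes

namespace Computes

open Data

variable {ι : Type} {μ : ι → ℕ} {f : ι → Data}

/-! #### Tables -/

/-- Building a table entry by entry. The entry at position `k` is computed in the environment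
extended by `k`; the continuation receives the weakening of computations to this environment, and
the computation of `k` in it. -/
theorem tabulate {n : ι → ℕ} {g : ∀ i, Fin (n i) → Data}
    (hn : Computes μ f fun i => ofNatUnary (n i))
    (hg : (∀ {x : ι → Data}, Computes μ f x → Computes (fun p : Σ i, Fin (n i) => μ p.1)
        (fun p => .cons (f p.1) (ofNatUnary p.2)) fun p => x p.1) →
      Computes (fun p : Σ i, Fin (n i) => μ p.1) (fun p => .cons (f p.1) (ofNatUnary p.2))
        (fun p => ofNatUnary p.2) →
      Computes (fun p : Σ i, Fin (n i) => μ p.1) (fun p => .cons (f p.1) (ofNatUnary p.2))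
        fun p => g p.1 p.2) :
    Computes μ f fun i => ofFun (g i) :=
  hn.range.map (hg (fun hx => hx.lift hn.range.elem_bdd) (var hn.range.elem_bdd))

/-- A table over a disjoint union. -/
theorem tableSum {m n : ι → ℕ} {g : ∀ i, Fin (m i + n i) → Data}
    (h₁ : Computes μ f fun i => ofFun fun k => g i (finSumFinEquiv (.inl k)))
    (h₂ : Computes μ f fun i => ofFun fun k => g i (finSumFinEquiv (.inr k))) :
    Computes μ f fun i => ofFun (g i) := by
  refine congr (append h₁ h₂) fun i => ?_
  rw [← List.ofFn_fin_append, ofFun]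
  congr 2
  exact Fin.append_castAdd_natAdd

/-- A table over a product. -/
theorem tableProd {m n : ι → ℕ} {g : ∀ i, Fin (m i * n i) → Data}
    (h : Computes μ f fun i => ofFun fun k => ofFun fun l => g i (finProdFinEquiv (k, l))) :
    Computes μ f fun i => ofFun (g i) := by
  have := flatten (L := fun i => List.ofFn fun k => List.ofFn fun l => g i (finProdFinEquiv (k, l)))
    (h.congr fun i => by rw [List.map_ofFn]; rfl)
  refine this.congr fun i => ?_
  rw [ofFun, List.ofFn_mul]
  simp [finProdFinEquiv, mul_comm, add_comm]

end Computes

namespace FinGame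

open Data

variable {ι : Type} {μ : ι → ℕ} {f : ι → Data} {H : ι → FinGame}

/-! ### Programs that read and write games -/

theorem computes_nS (hH : Computes μ f fun i => (H i).encode) :
    Computes μ f fun i => ofNatUnary (H i).nS := hH.hd

theorem computes_nA₁ (hH : Computes μ f fun i => (H i).encode) :
    Computes μ f fun i => ofNatUnary (H i).nA₁ := hH.tl.hd

theorem computes_nA₂ (hH : Computes μ f fun i => (H i).encode) :
    Computes μ f fun i => ofNatUnary (H i).nA₂ := hH.tl.tl.hd

/-- Looking up a transition probability. -/
theorem computes_δ (hH : Computes μ f fun i => (H i).encode)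
    {s : ∀ i, Fin (H i).nS} {a : ∀ i, Fin (H i).nA₁} {b : ∀ i, Fin (H i).nA₂}
    {t : ∀ i, Fin (H i).nS} (hs : Computes μ f fun i => ofNatUnary (s i))
    (ha : Computes μ f fun i => ofNatUnary (a i)) (hb : Computes μ f fun i => ofNatUnary (b i))
    (ht : Computes μ f fun i => ofNatUnary (t i)) :
    Computes μ f fun i => ofRat ((H i).toGame.δ (s i) (a i) (b i) (t i)) := by
  have h : Computes μ f fun i => ofFun fun s => ofFun fun a => ofFun fun b => ofFun fun t =>
    ofRat ((H i).toGame.δ s a b t) := hH.tl.tl.tl.hd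
  exact Computes.get t (Computes.get b (Computes.get a (Computes.get s h hs) ha) hb) ht

open Classical in
/-- Looking up a pair in an equivalence relation. -/
theorem computes_rel {n : ι → ℕ} {r : ∀ i, Setoid (Fin (n i))} {s t : ∀ i, Fin (n i)}
    (hr : Computes μ f fun i => ofSetoid (r i)) (hs : Computes μ f fun i => ofNatUnary (s i))
    (ht : Computes μ f fun i => ofNatUnary (t i)) :
    Computes μ f fun i => ofBool (decide (r i (s i) (t i))) := by
  have h : Computes μ f fun i => ofFun fun s => ofFun fun t => ofBool (decide (r i s t)) := hr
  exact Computes.get t (Computes.get s h hs) ht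

/-- The program for an encoding, from programs for its parts. -/
theorem computes_encode (h₁ : Computes μ f fun i => ofNatUnary (H i).nS)
    (h₂ : Computes μ f fun i => ofNatUnary (H i).nA₁)
    (h₃ : Computes μ f fun i => ofNatUnary (H i).nA₂)
    (h₄ : Computes μ f fun i => ofFun fun s => ofFun fun a => ofFun fun b => ofFun fun t =>
      ofRat ((H i).toGame.δ s a b t))
    (h₅ : Computes μ f fun i => ofSetoid (H i).toGame.obs₁)
    (h₆ : Computes μ f fun i => ofSetoid (H i).toGame.obs₂) :
    Computes μ f fun i => (H i).encode :=
  h₁.cons (h₂.cons (h₃.cons (h₄.cons (h₅.cons (h₆.cons (.const h₁.size_left .nil))))))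

/-- The game with the players exchanged. -/
def swap (G : FinGame) : FinGame where
  nS := G.nS
  nA₁ := G.nA₂
  nA₂ := G.nA₁
  nA₁_pos := G.nA₂_pos
  nA₂_pos := G.nA₁_pos
  toGame := G.toGame.swap

theorem computes_swap (hH : Computes μ f fun i => (H i).encode) :
    Computes μ f fun i => (H i).swap.encode := by
  refine computes_encode (H := fun i => (H i).swap) (computes_nS (H := H) hH)
    (computes_nA₂ (H := H) hH) (computes_nA₁ (H := H) hH) ?_
    hH.tl.tl.tl.tl.tl.hd hH.tl.tl.tl.tl.hd
  refine (computes_nS (H := H) hH).tabulate fun w s => ?_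
  refine (computes_nA₂ (w hH)).tabulate fun w' b => ?_
  refine (computes_nA₁ (w' (w hH))).tabulate fun w'' a => ?_
  refine (computes_nS (w'' (w' (w hH)))).tabulate fun w₃ t => ?_
  exact computes_δ (w₃ (w'' (w' (w hH)))) (w₃ (w'' (w' s))) (w₃ a) (w₃ (w'' b)) t

/-- The numbering of the states and intermediate states of the sequential game; the states of the
given game keep their numbers. -/
def splitState (m n : ℕ) : Fin (m + m * n) ≃ Fin m ⊕ Fin m × Fin n :=
  finSumFinEquiv.symm.trans (Equiv.sumCongr (Equiv.refl _) finProdFinEquiv.symm)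

/-- The sequential game, see `Game.sequentialize`. -/
def sequentialize (G : FinGame) (vis : Bool) : FinGame where
  nS := G.nS + G.nS * G.nA₂
  nA₁ := G.nA₁
  nA₂ := G.nA₂
  nA₁_pos := G.nA₁_pos
  nA₂_pos := G.nA₂_pos
  toGame := G.toGame.sequentialize (splitState G.nS G.nA₂) vis

/-- Tables over the states and intermediate states. -/
theorem table_split {m n : ι → ℕ} {g : ∀ i, Fin (m i + m i * n i) → Data}
    (h₁ : Computes μ f fun i => ofFun fun s => g i ((splitState (m i) (n i)).symm (.inl s)))
    (h₂ : Computes μ f fun i => ofFun fun s => ofFun fun c =>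
      g i ((splitState (m i) (n i)).symm (.inr (s, c)))) :
    Computes μ f fun i => ofFun (g i) := by
  refine Computes.tableSum (h₁.congr fun i => ?_) (Computes.tableProd (h₂.congr fun i => ?_))
  · simp only [splitState, Equiv.symm_trans_apply, Equiv.symm_symm, Equiv.sumCongr_symm,
      Equiv.refl_symm, Equiv.sumCongr_apply, Sum.map_inl, Equiv.refl_apply]
  · simp only [splitState, Equiv.symm_trans_apply, Equiv.symm_symm, Equiv.sumCongr_symm,
      Equiv.sumCongr_apply, Sum.map_inr]

end FinGame

namespace FinGame

open Data

variable {ι : Type} {μ : ι → ℕ} {f : ι → Data} {H : ι → FinGame}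

/-! ### A program for the sequential game -/

theorem computes_ite_one_zero {b : ι → Bool} (h : Computes μ f fun i => ofBool (b i)) :
    Computes μ f fun i => ofRat (if b i then 1 else 0) := by
  refine (h.ite (.const h.size_left (ofRat 1)) (.const h.size_left (ofRat 0))).congr fun i => ?_
  cases b i <;> rfl

theorem computes_bot {n : ι → ℕ} (hn : Computes μ f fun i => ofNatUnary (n i)) :
    Computes μ f fun i => ofSetoid (⊥ : Setoid (Fin (n i))) := by
  refine hn.tabulate fun w s => (w hn).tabulate fun w' t => ?_
  refine ((w' s).eq t).congr fun p => ?_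
  congr 1
  rw [decide_eq_decide]
  exact Fin.ext_iff.symm

theorem computes_hiddenObs {m n : ι → ℕ} {r : ∀ i, Setoid (Fin (m i))}
    (hm : Computes μ f fun i => ofNatUnary (m i)) (hn : Computes μ f fun i => ofNatUnary (n i))
    (hr : Computes μ f fun i => ofSetoid (r i)) :
    Computes μ f fun i => ofSetoid (Game.hiddenObs (splitState (m i) (n i)) (r i)) := by
  refine table_split ?_ ?_
  · refine hm.tabulate fun w s => table_split ?_ ?_
    · refine (w hm).tabulate fun w' t => ?_
      refine (computes_rel (w' (w hr)) (w' s) t).congr fun p => ?_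
      congr 1
      rw [decide_eq_decide]
      simp [Game.hiddenObs_iff, Game.baseState]
    · refine (w hm).tabulate fun w' t => (w' (w hn)).tabulate fun w'' d => ?_
      refine (Computes.const d.size_left (ofBool false)).congr fun p => ?_
      congr 1
      symm
      simp [Game.hiddenObs_iff]
  · refine hm.tabulate fun w s => (w hn).tabulate fun w₁ c => table_split ?_ ?_
    · refine (w₁ (w hm)).tabulate fun w' t => ?_
      refine (Computes.const t.size_left (ofBool false)).congr fun p => ?_
      congr 1
      symm
      simp [Game.hiddenObs_iff]
    · refine (w₁ (w hm)).tabulate fun w' t => (w' (w₁ (w hn))).tabulate fun w'' d => ?_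
      refine (computes_rel (w'' (w' (w₁ (w hr)))) (w'' (w' (w₁ s))) (w'' t)).congr fun p => ?_
      congr 1
      rw [decide_eq_decide]
      simp [Game.hiddenObs_iff, Game.baseState]

/-- The four cases of the transition table are the transitions from a state or an intermediate state
to a state or an intermediate state. -/
theorem computes_sequentialize (vis : Bool) (hH : Computes μ f fun i => (H i).encode) :
    Computes μ f fun i => ((H i).sequentialize vis).encode := by
  have hS := computes_nS (H := H) hH
  have hA₁ := computes_nA₁ (H := H) hH
  have hA₂ := computes_nA₂ (H := H) hH
  have hS' := hS.add (hS.mul hA₂)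
  refine computes_encode (H := fun i => (H i).sequentialize vis) hS' hA₁ hA₂ ?_
    (computes_hiddenObs hS hA₂ hH.tl.tl.tl.tl.hd) ?_
  · refine table_split ?_ ?_
    · refine hS.tabulate fun w s => (w hA₁).tabulate fun w₁ d =>
        (w₁ (w hA₂)).tabulate fun w₂ c => table_split ?_ ?_
      · refine (w₂ (w₁ (w hS))).tabulate fun w' t => ?_
        refine (Computes.const t.size_left (ofRat 0)).congr fun p => ?_
        simp [sequentialize, Game.sequentialize, Game.seqδ]
      · refine (w₂ (w₁ (w hS))).tabulate fun w' t =>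
          (w' (w₂ (w₁ (w hA₂)))).tabulate fun w'' c' => ?_
        refine (computes_ite_one_zero
          (((w'' t).eq (w'' (w' (w₂ (w₁ s))))).and (c'.eq (w'' (w' c))))).congr fun p => ?_
        simp [sequentialize, Game.sequentialize, Game.seqδ, Fin.ext_iff]
    · refine hS.tabulate fun w s => (w hA₂).tabulate fun w₁ c => (w₁ (w hA₁)).tabulate fun w₂ d =>
        (w₂ (w₁ (w hA₂))).tabulate fun w₃ c' => table_split ?_ ?_
      · refine (w₃ (w₂ (w₁ (w hS)))).tabulate fun w₄ t => ?_
        refine (computes_δ (w₄ (w₃ (w₂ (w₁ (w hH))))) (w₄ (w₃ (w₂ (w₁ s)))) (w₄ (w₃ d))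
          (w₄ (w₃ (w₂ c))) t).congr fun p => ?_
        simp [sequentialize, Game.sequentialize, Game.seqδ]
      · refine (w₃ (w₂ (w₁ (w hS)))).tabulate fun w₄ t =>
          (w₄ (w₃ (w₂ (w₁ (w hA₂))))).tabulate fun w₅ d => ?_
        refine (Computes.const d.size_left (ofRat 0)).congr fun p => ?_
        simp [sequentialize, Game.sequentialize, Game.seqδ]
  · cases vis
    · exact computes_hiddenObs hS hA₂ hH.tl.tl.tl.tl.tl.hd
    · exact computes_bot hS'

end FinGame

namespace FinGame

open Data

/-! ### Selecting successors by numbers -/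

/-- A common denominator of the transition probabilities: the product of all denominators. -/
def commonDen (G : FinGame) : ℕ := ∏ s, ∏ a, ∏ b, ∏ t, (G.toGame.δ s a b t).den

section Selection

variable (G : FinGame) (s : Fin G.nS) (a : Fin G.nA₁) (b : Fin G.nA₂)

theorem prod_a_dvd : ∏ a, ∏ b, ∏ t, (G.toGame.δ s a b t).den ∣ G.commonDen :=
  Finset.dvd_prod_of_mem (fun s => ∏ a, ∏ b, ∏ t, (G.toGame.δ s a b t).den) (Finset.mem_univ s)

theorem prod_b_dvd : ∏ b, ∏ t, (G.toGame.δ s a b t).den ∣ G.commonDen :=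
  (Finset.dvd_prod_of_mem (fun a => ∏ b, ∏ t, (G.toGame.δ s a b t).den) (Finset.mem_univ a)).trans
    (G.prod_a_dvd s)

theorem prod_t_dvd : ∏ t, (G.toGame.δ s a b t).den ∣ G.commonDen :=
  (Finset.dvd_prod_of_mem (fun b => ∏ t, (G.toGame.δ s a b t).den) (Finset.mem_univ b)).trans
    (G.prod_b_dvd s a)

theorem den_dvd (t : Fin G.nS) : (G.toGame.δ s a b t).den ∣ G.commonDen :=
  (Finset.dvd_prod_of_mem (fun t => (G.toGame.δ s a b t).den) (Finset.mem_univ t)).trans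
    (G.prod_t_dvd s a b)

theorem commonDen_pos : 0 < G.commonDen :=
  Finset.prod_pos fun _ _ => Finset.prod_pos fun _ _ => Finset.prod_pos fun _ _ =>
    Finset.prod_pos fun _ _ => Rat.den_pos _

instance : NeZero G.commonDen := ⟨G.commonDen_pos.ne'⟩

/-- The numerator of the transition probability with respect to the common denominator. -/
def weight (t : Fin G.nS) : ℕ :=
  (G.toGame.δ s a b t).num.natAbs * (G.commonDen / (G.toGame.δ s a b t).den)

theorem cast_weight (t : Fin G.nS) :
    (G.weight s a b t : ℚ) = G.commonDen * G.toGame.δ s a b t := by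
  have h₁ : ((G.toGame.δ s a b t).num.natAbs : ℚ) = (G.toGame.δ s a b t).num := by
    have := Int.natAbs_of_nonneg (Rat.num_nonneg.2 (G.toGame.δ_nonneg s a b t))
    rw [← Int.cast_natCast, this]
  have h₂ : ((G.toGame.δ s a b t).den : ℚ) ≠ 0 := by exact_mod_cast Rat.den_nz _
  rw [weight, Nat.cast_mul, Nat.cast_div (G.den_dvd s a b t) h₂, h₁]
  conv_rhs => rw [← Rat.num_div_den (G.toGame.δ s a b t)]
  ring

theorem sum_weight : ∑ t, G.weight s a b t = G.commonDen := by
  have : ((∑ t, G.weight s a b t : ℕ) : ℚ) = G.commonDen := by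
    rw [Nat.cast_sum]
    simp only [cast_weight]
    rw [← Finset.mul_sum, G.toGame.δ_sum, mul_one]
  exact_mod_cast this

theorem weight_le (t : Fin G.nS) : G.weight s a b t ≤ G.commonDen :=
  (Finset.single_le_sum (fun _ _ => Nat.zero_le _) (Finset.mem_univ t)).trans_eq
    (G.sum_weight s a b)

/-- The list in which every state occurs as often as its weight says. -/
def selection : List (Fin G.nS) :=
  (List.ofFn fun t => List.replicate (G.weight s a b t) t).flatten

theorem length_selection : (G.selection s a b).length = G.commonDen := by
  rw [selection, List.length_flatten, List.map_ofFn, List.sum_ofFn, ← G.sum_weight s a b]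
  simp

theorem count_selection (t : Fin G.nS) : (G.selection s a b).count t = G.weight s a b t := by
  rw [selection, List.count_flatten, List.map_ofFn, List.sum_ofFn]
  simp [List.count_replicate]

/-- The successor that is selected by a number below the common denominator. -/
def select (r : Fin G.commonDen) : Fin G.nS :=
  (G.selection s a b)[r]'((G.length_selection s a b).symm ▸ r.2)

theorem ofFn_select : List.ofFn (G.select s a b) = G.selection s a b :=
  List.ext_getElem (by simp [length_selection]) fun n _ _ => by simp [select]

theorem selects : G.toGame.Selects G.select := by
  intro s a b t
  rw [← cast_weight, ← count_selection, ← ofFn_select, Nat.card_eq_fintype_card,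
    Fintype.card_subtype, ← Multiset.coe_count, ← Fin.univ_val_map, Multiset.count_map]
  simp only [eq_comm]
  rfl

end Selection

/-- The deterministic game, see `Game.determinize`: every action is paired with a number below the
common denominator. -/
def determinize (G : FinGame) : FinGame where
  nS := G.nS
  nA₁ := G.nA₁ * G.commonDen
  nA₂ := G.nA₂ * G.commonDen
  nA₁_pos := Nat.mul_pos G.nA₁_pos G.commonDen_pos
  nA₂_pos := Nat.mul_pos G.nA₂_pos G.commonDen_pos
  toGame := G.toGame.determinize finProdFinEquiv.symm finProdFinEquiv.symm G.select

theorem commonDen_swap (G : FinGame) : G.swap.commonDen = G.commonDen :=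
  Finset.prod_congr rfl fun _ _ => Finset.prod_comm

end FinGame

/-! ### A program for the deterministic game -/

/-- The product of a family of positive numbers that are computed from their position; see
`Computes.tabulate` for the continuation. -/
theorem Computes.prodRange {ι : Type} {μ : ι → ℕ} {f : ι → Data} {n : ι → ℕ}
    {m : ∀ i, Fin (n i) → ℕ} (hpos : ∀ i k, 0 < m i k) (hB : PolyBdd μ fun i => ∏ k, m i k)
    (hn : Computes μ f fun i => .ofNatUnary (n i))
    (hm : (∀ {x : ι → Data}, Computes μ f x → Computes (fun p : Σ i, Fin (n i) => μ p.1)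
        (fun p => .cons (f p.1) (.ofNatUnary p.2)) fun p => x p.1) →
      Computes (fun p : Σ i, Fin (n i) => μ p.1) (fun p => .cons (f p.1) (.ofNatUnary p.2))
        (fun p => .ofNatUnary p.2) →
      Computes (fun p : Σ i, Fin (n i) => μ p.1) (fun p => .cons (f p.1) (.ofNatUnary p.2))
        fun p => .ofNatUnary (m p.1 p.2)) :
    Computes μ f fun i => .ofNatUnary (∏ k, m i k) :=
  prod hpos hB hn.range (hm (fun hx => hx.lift hn.range.elem_bdd) (var hn.range.elem_bdd))

namespace FinGame

open Data

variable {ι : Type} {μ : ι → ℕ} {f : ι → Data} {H : ι → FinGame}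

/-- The common denominator is computed in unary, hence the bound `hN`. -/
theorem computes_commonDen (hH : Computes μ f fun i => (H i).encode)
    (hN : PolyBdd μ fun i => (H i).commonDen) :
    Computes μ f fun i => ofNatUnary (H i).commonDen := by
  have hS := computes_nS (H := H) hH
  have hA₁ := computes_nA₁ (H := H) hH
  have hA₂ := computes_nA₂ (H := H) hH
  refine hS.prodRange (fun _ _ => Finset.prod_pos fun _ _ => Finset.prod_pos fun _ _ =>
    Finset.prod_pos fun _ _ => Rat.den_pos _) hN fun w₁ s => ?_
  refine (w₁ hA₁).prodRange (fun _ _ => Finset.prod_pos fun _ _ =>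
    Finset.prod_pos fun _ _ => Rat.den_pos _) ((hN.comp _).mono fun _ =>
      Nat.le_of_dvd (commonDen_pos _) (prod_a_dvd _ _)) fun w₂ a => ?_
  refine (w₂ (w₁ hA₂)).prodRange (fun _ _ =>
    Finset.prod_pos fun _ _ => Rat.den_pos _) (((hN.comp _).comp _).mono fun _ =>
      Nat.le_of_dvd (commonDen_pos _) (prod_b_dvd _ _ _)) fun w₃ b => ?_
  refine (w₃ (w₂ (w₁ hS))).prodRange (fun _ _ => Rat.den_pos _)
    ((((hN.comp _).comp _).comp _).mono fun _ =>
      Nat.le_of_dvd (commonDen_pos _) (prod_t_dvd _ _ _ _)) fun w₄ t => ?_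
  exact Computes.unary_of_binary (((((hN.comp _).comp _).comp _).comp _).mono fun _ =>
      Nat.le_of_dvd (commonDen_pos _) (den_dvd _ _ _ _ _))
    (computes_δ (w₄ (w₃ (w₂ (w₁ hH)))) (w₄ (w₃ (w₂ s))) (w₄ (w₃ a)) (w₄ b) t).tl

theorem computes_weight (hH : Computes μ f fun i => (H i).encode)
    (hN : PolyBdd μ fun i => (H i).commonDen)
    {s : ∀ i, Fin (H i).nS} {a : ∀ i, Fin (H i).nA₁} {b : ∀ i, Fin (H i).nA₂}
    {t : ∀ i, Fin (H i).nS} (hs : Computes μ f fun i => ofNatUnary (s i))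
    (ha : Computes μ f fun i => ofNatUnary (a i)) (hb : Computes μ f fun i => ofNatUnary (b i))
    (ht : Computes μ f fun i => ofNatUnary (t i)) :
    Computes μ f fun i => ofNatUnary ((H i).weight (s i) (a i) (b i) (t i)) := by
  have hδ := computes_δ hH hs ha hb ht
  have hden := Computes.unary_of_binary (hN.mono fun i =>
    Nat.le_of_dvd (commonDen_pos _) (den_dvd (H i) (s i) (a i) (b i) (t i))) hδ.tl
  refine (Computes.unary_of_binary (hN.mono fun i => ?_) hδ.hd).mul
    (Computes.div (fun i => den_dvd _ _ _ _ _) (fun i => Rat.den_pos _)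
      (computes_commonDen hH hN) hden)
  -- The numerator is at most the weight, and the weight at most the common denominator.
  refine le_trans ?_ ((H i).weight_le (s i) (a i) (b i) (t i))
  exact Nat.le_mul_of_pos_right _ (Nat.div_pos
    (Nat.le_of_dvd (commonDen_pos _) (den_dvd _ _ _ _ _)) (Rat.den_pos _))

theorem computes_select (hH : Computes μ f fun i => (H i).encode)
    (hN : PolyBdd μ fun i => (H i).commonDen)
    {s : ∀ i, Fin (H i).nS} {a : ∀ i, Fin (H i).nA₁} {b : ∀ i, Fin (H i).nA₂}
    {r : ∀ i, Fin (H i).commonDen} (hs : Computes μ f fun i => ofNatUnary (s i))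
    (ha : Computes μ f fun i => ofNatUnary (a i)) (hb : Computes μ f fun i => ofNatUnary (b i))
    (hr : Computes μ f fun i => ofNatUnary (r i)) :
    Computes μ f fun i => ofNatUnary ((H i).select (s i) (a i) (b i) (r i)) := by
  have hL : Computes μ f fun i => ofList
      (((H i).selection (s i) (a i) (b i)).map fun t : Fin _ => ofNatUnary t) := by
    have : Computes μ f fun i => ofFun fun t : Fin (H i).nS =>
        ofList (List.replicate ((H i).weight (s i) (a i) (b i) t) (ofNatUnary t)) :=
      (computes_nS (H := H) hH).tabulate fun w t =>
        (computes_weight (w hH) (hN.comp _) (w hs) (w ha) (w hb) t).replicate t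
    refine (Computes.flatten (L := fun i => List.ofFn fun t : Fin (H i).nS =>
      List.replicate ((H i).weight (s i) (a i) (b i) t) (ofNatUnary t))
      (this.congr fun i => by rw [List.map_ofFn]; rfl)).congr fun i => ?_
    rw [selection, List.map_flatten, List.map_ofFn]
    congr 3
    funext t
    simp
  refine (Computes.getElem (fun i => ?_) hL hr).congr fun i => ?_
  · rw [List.length_map, length_selection]
    exact (r i).2
  · rw [List.getElem_map]
    rfl

theorem computes_determinize (hH : Computes μ f fun i => (H i).encode)
    (hN : PolyBdd μ fun i => (H i).commonDen) :
    Computes μ f fun i => (H i).determinize.encode := by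
  have hS := computes_nS (H := H) hH
  have hA₁ := computes_nA₁ (H := H) hH
  have hA₂ := computes_nA₂ (H := H) hH
  have hD := computes_commonDen hH hN
  refine computes_encode (H := fun i => (H i).determinize) hS (hA₁.mul hD) (hA₂.mul hD) ?_
    hH.tl.tl.tl.tl.hd hH.tl.tl.tl.tl.tl.hd
  refine hS.tabulate fun w₁ s => ?_
  refine Computes.tableProd ((w₁ hA₁).tabulate fun w₂ a => (w₂ (w₁ hD)).tabulate fun w₃ j => ?_)
  refine Computes.tableProd ((w₃ (w₂ (w₁ hA₂))).tabulate fun w₄ b =>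
    (w₄ (w₃ (w₂ (w₁ hD)))).tabulate fun w₅ k => ?_)
  refine (w₅ (w₄ (w₃ (w₂ (w₁ hS))))).tabulate fun w₆ t => ?_
  have hD' := w₆ (w₅ (w₄ (w₃ (w₂ (w₁ hD)))))
  have hsum := (w₆ (w₅ (w₄ j))).add (w₆ k)
  refine (computes_ite_one_zero (Computes.eq (computes_select
    (H := fun p => H p.1.1.1.1.1.1) (s := fun p => p.1.1.1.1.1.2) (a := fun p => p.1.1.1.1.2)
    (b := fun p => p.1.1.2) (r := fun p => p.1.1.1.2 + p.1.2)
    (w₆ (w₅ (w₄ (w₃ (w₂ (w₁ hH)))))) ((((((hN.comp _).comp _).comp _).comp _).comp _).comp _)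
    (w₆ (w₅ (w₄ (w₃ (w₂ s))))) (w₆ (w₅ (w₄ (w₃ a)))) (w₆ (w₅ b))
    (((hD'.le hsum).ite (hsum.sub hD') hsum).congr fun p => ?_)) t)).congr fun p => ?_
  · rw [Fin.val_add_eq_ite]
    simp only [decide_eq_true_eq]
    split_ifs <;> rfl
  · simp only [determinize, Game.determinize, Equiv.symm_apply_apply, Fin.ext_iff,
      decide_eq_true_eq]

end FinGame

namespace Data

/-! ### The size of the common denominator -/

theorem prod_le_two_pow_size {n : ℕ} {m : Fin n → ℕ} {x : Fin n → Data}
    (h : ∀ k, m k ≤ 2 ^ (x k).size) : ∏ k, m k ≤ 2 ^ (ofFun x).size := by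
  refine (Finset.prod_le_prod' fun k _ => h k).trans ?_
  rw [Finset.prod_pow_eq_pow_sum, ofFun, size_ofList, List.map_ofFn, List.sum_ofFn]
  refine Nat.pow_le_pow_right two_pos (le_add_left (Finset.sum_le_sum fun k _ => ?_))
  exact Nat.le_succ _

theorem le_two_pow_size_ofNat (n : ℕ) : n ≤ 2 ^ (ofNat n).size := by
  refine (Nat.lt_size_self n).le.trans (Nat.pow_le_pow_right two_pos ?_)
  rw [← Nat.size_eq_bits_len, ofNat, ← List.length_map ofBool]
  exact length_le_size_ofList _

end Data

namespace FinGame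

open Data

/-- A number has at most as many bits as the tree that encodes it has nodes, and the sizes of the
entries of a table add up. -/
theorem commonDen_le (G : FinGame) : G.commonDen ≤ 2 ^ G.encode.size := by
  refine (prod_le_two_pow_size fun s => prod_le_two_pow_size fun a => prod_le_two_pow_size fun b =>
    prod_le_two_pow_size (x := fun t => ofRat (G.toGame.δ s a b t)) fun t =>
    (le_two_pow_size_ofNat _).trans (Nat.pow_le_pow_right two_pos ?_)).trans
    (Nat.pow_le_pow_right two_pos ?_)
  · simp only [ofRat, size]
    omega
  · simp only [encode, ofList, size]
    omega

section Programs

variable {ι : Type} {μ : ι → ℕ} {f : ι → Data} {H : ι → FinGame}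

/-- Whether a player has complete observation can be tested. -/
theorem computes_completeObs {n : ι → ℕ} {r : ∀ i, Setoid (Fin (n i))}
    [∀ i, Decidable (Game.CompleteObs (r i))] (hn : Computes μ f fun i => ofNatUnary (n i))
    (hr : Computes μ f fun i => ofSetoid (r i)) :
    Computes μ f fun i => ofBool (decide (Game.CompleteObs (r i))) := by
  classical
  have h : Computes μ f fun i => ofBool (decide (∀ s, decide (∀ t,
      (if r i s t then decide (s = t) else true) = true) = true)) := by
    refine Computes.all hn.range ?_
    have hs := Computes.var hn.range.elem_bdd
    have hn' := hn.lift hn.range.elem_bdd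
    refine Computes.all hn'.range ?_
    have ht := Computes.var hn'.range.elem_bdd
    refine (Computes.ofBool_ite (computes_rel ((hr.lift hn.range.elem_bdd).lift
      hn'.range.elem_bdd) (hs.lift hn'.range.elem_bdd) ht)
      ((hs.lift hn'.range.elem_bdd).eq ht)
      (.const ht.size_left (ofBool true))).congr fun p => ?_
    simp [Fin.ext_iff]
  refine h.congr fun i => ?_
  congr 1
  rw [decide_eq_decide]
  simp [Game.CompleteObs, or_iff_not_imp_left]

end Programs

end FinGame

/-! ### From a transformation of games to the theorem -/

theorem measurableSet_liftObjective {S S' : Type} [MeasurableSpace S] [DiscreteMeasurableSpace S]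
    [MeasurableSpace S'] [DiscreteMeasurableSpace S'] (k : ℕ) {e : S → S'}
    (he : Function.Injective e) {φ : Set (ℕ → S)} (hφ : MeasurableSet φ) :
    MeasurableSet (liftObjective k e φ) := by
  -- Without states there are no sequences, and `e` has no left inverse.
  rcases isEmpty_or_nonempty S with hS | hS
  · convert MeasurableSet.empty
    exact Set.eq_empty_of_forall_notMem fun _ ⟨ρ, _, _⟩ => isEmptyElim (ρ 0)
  obtain ⟨r, hr⟩ := he.hasLeftInverse
  have : liftObjective k e φ = (⋂ i, (fun ρ' : ℕ → S' => ρ' (k * i)) ⁻¹' Set.range e) ∩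
      (fun ρ' i => r (ρ' (k * i))) ⁻¹' φ := by
    ext ρ'
    simp only [liftObjective, Set.mem_ofPred_eq, Set.mem_inter_iff, Set.mem_iInter,
      Set.mem_preimage, Set.mem_range]
    constructor
    · rintro ⟨ρ, hρ, h⟩
      refine ⟨fun i => ⟨ρ i, (h i).symm⟩, ?_⟩
      simpa only [h, hr _] using hρ
    · rintro ⟨h, h'⟩
      refine ⟨_, h', fun i => ?_⟩
      obtain ⟨t, ht⟩ := h i
      rw [← ht, hr]
  rw [this]
  refine (MeasurableSet.iInter fun i => (measurable_pi_apply _) (.of_discrete)).inter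
    ((show Measurable fun (ρ' : ℕ → S') i => r (ρ' (k * i)) from ?_) hφ)
  exact measurable_pi_lambda _ fun i =>
    (Measurable.of_discrete (f := r)).comp (measurable_pi_apply _)

/-- A transformation suffices that is computed in time polynomial in `2 ^ size` and whose results
simulate the given games: `(2 ^ m + 2) ^ c ≤ 2 ^ ((m + 2) * c)`. -/
theorem exists_program_of_transformation {a : ObsClass} {b : Interaction} {k : ℕ} (hk : 0 < k)
    (T : FinGame → FinGame)
    (hT : Computes (fun G => 2 ^ G.encode.size) FinGame.encode fun G => (T G).encode)
    (hsim : ∀ G : FinGame, G.toGame.InClass a b → ∃ hS : G.nS ≤ (T G).nS,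
      (T G).toGame.InClass a.atLeastOneSided b ∧ (T G).toGame.Deterministic ∧
      Nonempty (Game.Simulation G.toGame (T G).toGame (Fin.castLE hS) k)) :
    ∃ (P : Program) (p : Polynomial ℕ) (k : ℕ), 0 < k ∧
      ∀ G : FinGame, G.toGame.InClass a b →
        ∃ (G' : FinGame) (t : ℕ) (hS : G.nS ≤ G'.nS),
          Runs P G.encode G'.encode t ∧ t ≤ 2 ^ p.eval G.encode.size ∧
          G'.toGame.InClass a.atLeastOneSided b ∧ G'.toGame.Deterministic ∧
          ∀ φ : Set (ℕ → Fin G.nS), MeasurableSet φ →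
            ∃ φ' : Set (ℕ → Fin G'.nS),
              φ' = liftObjective k (Fin.castLE hS) φ ∧ MeasurableSet φ' ∧
              ∀ s : Fin G.nS,
                ((∃ σ, G.toGame.AlmostSureWinning φ s σ) ↔
                  ∃ σ, G'.toGame.AlmostSureWinning φ' (Fin.castLE hS s) σ) ∧
                ((∃ σ, G.toGame.PositiveWinning φ s σ) ↔
                  ∃ σ, G'.toGame.PositiveWinning φ' (Fin.castLE hS s) σ) ∧
                G.toGame.value φ s = G'.toGame.value φ' (Fin.castLE hS s) ∧
                ((∃ σ, G.toGame.Optimal φ s σ) ↔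
                  ∃ σ, G'.toGame.Optimal φ' (Fin.castLE hS s) σ) := by
  obtain ⟨P, c, hP⟩ := hT
  refine ⟨P, (Polynomial.X + Polynomial.C 2) * Polynomial.C c, k, hk, fun G hG => ?_⟩
  obtain ⟨hS, hcl, hdet, ⟨H⟩⟩ := hsim G hG
  obtain ⟨t, ht, hr⟩ := hP G
  refine ⟨T G, t, hS, hr, ht.trans ?_, hcl, hdet, fun φ hφ => ⟨_, rfl,
    measurableSet_liftObjective k (Fin.castLE_injective hS) hφ, fun s =>
      ⟨H.almostSureWinning_iff hφ s, H.positiveWinning_iff hφ s, H.value_eq hφ s,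
        H.optimal_iff hφ s⟩⟩⟩
  simp only [Polynomial.eval_mul, Polynomial.eval_add, Polynomial.eval_X, Polynomial.eval_C]
  rw [pow_mul, pow_add]
  refine Nat.pow_le_pow_left ?_ c
  have := Nat.one_le_two_pow (n := G.encode.size)
  omega

namespace FinGame

/-! ### The transformations -/

theorem mainState_splitState (m n : ℕ) :
    Game.mainState (splitState m n) = Fin.castLE (Nat.le_add_right m (m * n)) := by
  funext s
  simp [Game.mainState, splitState, finSumFinEquiv_apply_left]
  rfl

theorem determinize_simulation (G : FinGame) : Nonempty
    (Game.Simulation G.toGame G.determinize.toGame (Fin.castLE (le_refl G.nS)) 1) := by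
  have := Game.simulationDeterminize finProdFinEquiv.symm finProdFinEquiv.symm G.selects
  rw [← Fin.castLE_rfl] at this
  exact ⟨this⟩

/-- The deterministic game in sequential form; Player 2 sees his choices if and only if `vis`
holds. -/
def turns (G : FinGame) (vis : Bool) : FinGame := G.determinize.sequentialize vis

theorem le_turns (G : FinGame) (vis : Bool) : G.nS ≤ (G.turns vis).nS := Nat.le_add_right _ _

theorem turns_turnBased (G : FinGame) (vis : Bool) : (G.turns vis).toGame.TurnBased :=
  Game.sequentialize_turnBased _ _ _

theorem turns_deterministic (G : FinGame) (vis : Bool) : (G.turns vis).toGame.Deterministic :=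
  (Game.determinize_deterministic _ _ _ _).sequentialize _ _

theorem turns_simulation (G : FinGame) : Nonempty
    (Game.Simulation G.toGame (G.turns false).toGame (Fin.castLE (G.le_turns false)) 2) := by
  have := Game.simulationHidden finProdFinEquiv.symm finProdFinEquiv.symm
    (splitState G.nS (G.nA₂ * G.commonDen)) G.selects ⟨0, G.determinize.nA₂_pos⟩
  rw [mainState_splitState] at this
  exact ⟨this⟩

theorem turns_simulation_of_completeObs (G : FinGame) (hG : G.toGame.TurnBased)
    (hobs : Game.CompleteObs G.toGame.obs₂) : Nonempty
    (Game.Simulation G.toGame (G.turns true).toGame (Fin.castLE (G.le_turns true)) 2) := by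
  have := Game.simulationVisible finProdFinEquiv.symm finProdFinEquiv.symm
    (splitState G.nS (G.nA₂ * G.commonDen)) G.selects hG hobs ⟨0, G.nA₁_pos⟩ ⟨0, G.nA₂_pos⟩
    ⟨0, G.determinize.nA₂_pos⟩
  rw [mainState_splitState] at this
  exact ⟨this⟩

open Classical in
/-- The transformation of one-sided turn-based games: the player who chooses first is one with
complete observation. -/
def oneSidedTurns (G : FinGame) : FinGame :=
  if Game.CompleteObs G.toGame.obs₂ then G.turns true else (G.swap.turns true).swap

theorem polyBdd_commonDen :
    PolyBdd (fun G : FinGame => 2 ^ G.encode.size) fun G => G.commonDen :=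
  (PolyBdd.self _).mono commonDen_le

theorem computes_encode_self :
    Computes (fun G : FinGame => 2 ^ G.encode.size) encode encode :=
  .id ((PolyBdd.self _).mono fun _ => Nat.lt_two_pow_self.le)

theorem computes_turns (vis : Bool) :
    Computes (fun G : FinGame => 2 ^ G.encode.size) encode fun G => (G.turns vis).encode :=
  computes_sequentialize vis (computes_determinize computes_encode_self polyBdd_commonDen)

theorem computes_oneSidedTurns :
    Computes (fun G : FinGame => 2 ^ G.encode.size) encode fun G => G.oneSidedTurns.encode := by
  classical
  have hH := computes_encode_self
  refine ((computes_completeObs (computes_nS hH) hH.tl.tl.tl.tl.tl.hd).ite (computes_turns true)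
    (computes_swap (computes_sequentialize true (computes_determinize (computes_swap hH)
      (polyBdd_commonDen.mono fun G => (commonDen_swap G).le))))).congr fun G => ?_
  simp only [oneSidedTurns, decide_eq_true_eq]
  split_ifs <;> rfl

end FinGame

end

/-- For every class of games (observation restriction `a`, mode of interaction `b`), some program
transforms in exponential time every rational game of the class into a game with deterministic
transitions in the class `a' b`, whose states include those of the given game, and which simulates
one move of the given game by `k` moves. -/
theorem theorem3 (a : ObsClass) (b : Interaction) :
    ∃ (P : Program) (p : Polynomial ℕ) (k : ℕ), 0 < k ∧
      ∀ G : FinGame, G.toGame.InClass a b →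
        ∃ (G' : FinGame) (t : ℕ) (hS : G.nS ≤ G'.nS),
          Runs P G.encode G'.encode t ∧ t ≤ 2 ^ p.eval G.encode.size ∧
          G'.toGame.InClass a.atLeastOneSided b ∧ G'.toGame.Deterministic ∧
          ∀ φ : Set (ℕ → Fin G.nS), MeasurableSet φ →
            ∃ φ' : Set (ℕ → Fin G'.nS),
              φ' = liftObjective k (Fin.castLE hS) φ ∧ MeasurableSet φ' ∧
              ∀ s : Fin G.nS,
                ((∃ σ, G.toGame.AlmostSureWinning φ s σ) ↔
                  ∃ σ, G'.toGame.AlmostSureWinning φ' (Fin.castLE hS s) σ) ∧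
                ((∃ σ, G.toGame.PositiveWinning φ s σ) ↔
                  ∃ σ, G'.toGame.PositiveWinning φ' (Fin.castLE hS s) σ) ∧
                G.toGame.value φ s = G'.toGame.value φ' (Fin.castLE hS s) ∧
                ((∃ σ, G.toGame.Optimal φ s σ) ↔
                  ∃ σ, G'.toGame.Optimal φ' (Fin.castLE hS s) σ) := by
  match a, b with
  | .partialObs, .concurrent =>
    exact exists_program_of_transformation one_pos FinGame.determinize
      (FinGame.computes_determinize FinGame.computes_encode_self FinGame.polyBdd_commonDen)
      fun G hG => ⟨le_rfl, hG, Game.determinize_deterministic _ _ _ _, G.determinize_simulation⟩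
  | .oneSided, .concurrent =>
    exact exists_program_of_transformation one_pos FinGame.determinize
      (FinGame.computes_determinize FinGame.computes_encode_self FinGame.polyBdd_commonDen)
      fun G hG => ⟨le_rfl, hG, Game.determinize_deterministic _ _ _ _, G.determinize_simulation⟩
  | .complete, .concurrent =>
    exact exists_program_of_transformation one_pos FinGame.determinize
      (FinGame.computes_determinize FinGame.computes_encode_self FinGame.polyBdd_commonDen)
      fun G hG => ⟨le_rfl, ⟨.inl hG.1.1, trivial⟩, Game.determinize_deterministic _ _ _ _,
        G.determinize_simulation⟩
  | .partialObs, .turnBased =>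
    exact exists_program_of_transformation two_pos (fun G => G.turns false)
      (FinGame.computes_turns false) fun G _ => ⟨G.le_turns false, ⟨trivial, G.turns_turnBased _⟩,
        G.turns_deterministic _, G.turns_simulation⟩
  | .complete, .turnBased =>
    exact exists_program_of_transformation two_pos (fun G => G.turns true)
      (FinGame.computes_turns true) fun G hG => ⟨G.le_turns true,
        ⟨Game.sequentialize_oneSided _ _, G.turns_turnBased _⟩,
        G.turns_deterministic _, G.turns_simulation_of_completeObs hG.2 hG.1.2⟩
  | .oneSided, .turnBased =>
    refine exists_program_of_transformation two_pos FinGame.oneSidedTurns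
      FinGame.computes_oneSidedTurns fun G hG => ?_
    by_cases h : Game.CompleteObs G.toGame.obs₂
    · rw [FinGame.oneSidedTurns, if_pos h]
      exact ⟨G.le_turns true, ⟨Game.sequentialize_oneSided _ _, G.turns_turnBased _⟩,
        G.turns_deterministic _, G.turns_simulation_of_completeObs hG.2 h⟩
    · rw [FinGame.oneSidedTurns, if_neg h]
      obtain ⟨H⟩ := G.swap.turns_simulation_of_completeObs hG.2.swap (hG.1.resolve_right h)
      exact ⟨G.swap.le_turns true, ⟨(Game.sequentialize_oneSided _ _).symm,
        (G.swap.turns_turnBased true).swap⟩,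
        fun s a b => G.swap.turns_deterministic true s b a, ⟨H.swap⟩⟩
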